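/- **Definitions.** Let $\mathbb F$ be a field, $X$ a set of variables and $\preceq$ a linear order on $X$. A noncommutative formula is a binary tree whose leaves are labelled by variables or elements of $\mathbb F$ and whose inner nodes are (ordered) plus or product gates; it computes an element of $\mathbb F\langle X\rangle$, and its size is its number of nodes. For $f\in\mathbb F[X]$ let $[\![f]\!]\in\mathbb F\langle X\rangle$ be obtained by writing every monomial of $f$ in $\preceq$-nondecreasing order. An ordered formula is a noncommutative formula each of whose subformulas computes a polynomial in the image of $[\![\cdot]\!]$; it computes $f$ if its root computes $[\![f]\!]$. A PC (polynomial calculus) refutation of a set $Q\subseteq\mathbb F[X]$ is a finite sequence of polynomials ending in $1$, each of which is in $Q$, or is $x(1-x)$ with $x\in X$, or is $x\cdot p$ ($x\in X$) or $a p+b q$ ($a,b\in\mathbb F$) for earlier lines $p,q$. An OFPC refutation of $Q$ (over $\mathbb F$, with order $\preceq$) is a sequence of ordered formulas computing, line by line, a PC refutation of $Q$; its size is the sum of the sizes of the formulas. $\mathrm{FPHP}^m_n$ consists of the polynomials, in the variables $x_{i,k}$ ($i\in[m]$, $k\in[n]$), $$\prod_{k=1}^n(1-x_{i,k})\ (i\in[m]),\qquad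 x_{i,k}x_{i,\ell}\ (i\in[m],\,k<\ell\in[n]),\qquad x_{i,k}x_{j,k}\ (i<j\in[m],\,k\in[n]).$$ **Statement.** (1) There are polynomials $p,q$ with natural number coefficients such that for all natural numbers $m>n$, every field $\mathbb F$ with more than $q(n)$ elements (possibly infinite) and every linear order on the variables $x_{i,k}$, there is an OFPC refutation of $\mathrm{FPHP}^m_n$ over $\mathbb F$ of size at most $p(n)$. (2) For every infinite field $\mathbb F$ and every linear order on the variables $x_0,x_1,x_2,\dots$, OFPC over $\mathbb F$ is strictly stronger than resolution as a refutation system for CNF formulas in these variables. That is: there is a polynomial $p$ such that whenever a CNF formula $K$ has a resolution refutation with $s$ clauses, the polynomial translation of $K$ has an OFPC refutation of size at most $p(s)$; and there is no polynomial $p$ such that whenever the polynomial translation of a CNF formula $K$ has an OFPC refutation of size $s$, $K$ has a resolution refutation with at most $p(s)$ clauses. Here a clause is a finite set of literals, a CNF formula is a finite set of clauses, a resolution refutation is a sequence of clauses ending in the empty clause, each of which is a clause of $K$ or results from two earlier clauses by the resolution rule, and the polynomial translation of $K$ consists of the products $\prod_{x\in C}(x-1)\cdot\prod_{\neg x\in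 C}x$ for the clauses $C$ of $K$. -/

import Mathlib

universe u

namespace OrderedPC

noncomputable section

/-! ### Noncommutative formulas and ordered formulas -/

/-- Noncommutative formulas over `F` with variables in `X`: ordered binary trees whose leaves are
labelled by variables or field elements and whose inner nodes are plus or product gates. -/
inductive NCFormula (F X : Type*) where
  | var (x : X) : NCFormula F X
  | const (a : F) : NCFormula F X
  | add (f g : NCFormula F X) : NCFormula F X
  | mul (f g : NCFormula F X) : NCFormula F X

namespace NCFormula

variable {F X : Type*}

/-- The size of a formula: the number of nodes of its tree. -/
def size : NCFormula F X → ℕ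
  | var _ => 1
  | const _ => 1
  | add f g => f.size + g.size + 1
  | mul f g => f.size + g.size + 1

/-- The noncommutative polynomial in `F⟨X⟩` computed by a formula. -/
def eval [Field F] : NCFormula F X → FreeAlgebra F X
  | var x => FreeAlgebra.ι F x
  | const a => algebraMap F (FreeAlgebra F X) a
  | add f g => f.eval + g.eval
  | mul f g => f.eval * g.eval

end NCFormula

section Ordered

variable {F X : Type*} [Field F]

/-- The noncommutative product of the variables of the monomial with exponent vector `d`
(with multiplicity), multiplied in nondecreasing order with respect to `ord`. -/
def orderedMonomial (F : Type*) {X : Type*} [Field F] (ord : LinearOrder X) (d : X →₀ ℕ) :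
    FreeAlgebra F X :=
  letI := ord
  (((Finsupp.toMultiset d).sort (fun a b => a ≤ b)).map (FreeAlgebra.ι F)).prod

/-- The map `f ↦ ⟦f⟧` from commutative to noncommutative polynomials which writes
every monomial of `f` in nondecreasing order. -/
def bracket (ord : LinearOrder X) (f : MvPolynomial X F) : FreeAlgebra F X :=
  ∑ d ∈ f.support, f.coeff d • orderedMonomial F ord d

/-- A noncommutative polynomial is ordered if it lies in the image of `⟦·⟧`. -/
def IsOrderedPoly (ord : LinearOrder X) (q : FreeAlgebra F X) : Prop :=
  ∃ f : MvPolynomial X F, bracket ord f = q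

/-- An ordered formula: every subformula computes an ordered polynomial. -/
def IsOrderedFormula (ord : LinearOrder X) : NCFormula F X → Prop
  | .var x => IsOrderedPoly ord (NCFormula.var x : NCFormula F X).eval
  | .const a => IsOrderedPoly ord (NCFormula.const a : NCFormula F X).eval
  | .add f g => IsOrderedPoly ord (NCFormula.add f g).eval ∧
      IsOrderedFormula ord f ∧ IsOrderedFormula ord g
  | .mul f g => IsOrderedPoly ord (NCFormula.mul f g).eval ∧
      IsOrderedFormula ord f ∧ IsOrderedFormula ord g

/-- `φ` is an ordered formula computing the commutative polynomial `p`. -/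
def OrderedComputes (ord : LinearOrder X) (φ : NCFormula F X) (p : MvPolynomial X F) : Prop :=
  IsOrderedFormula ord φ ∧ φ.eval = bracket ord p

end Ordered

/-! ### Polynomial calculus and polynomial calculus over ordered formulas -/

section PC

variable {F X : Type*} [Field F]

/-- `p` is an initial polynomial, a Boolean axiom, or follows by the product rule or the addition
rule from lines in `prev`. -/
def PCStep (Q : Set (MvPolynomial X F)) (prev : List (MvPolynomial X F))
    (p : MvPolynomial X F) : Prop :=
  p ∈ Q ∨
  (∃ x : X, p = MvPolynomial.X x * (1 - MvPolynomial.X x)) ∨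
  (∃ x : X, ∃ q ∈ prev, p = MvPolynomial.X x * q) ∨
  (∃ a b : F, ∃ q ∈ prev, ∃ r ∈ prev, p = MvPolynomial.C a * q + MvPolynomial.C b * r)

/-- Every line of `π` is justified from the lines that precede it. -/
def IsPCProof (Q : Set (MvPolynomial X F)) (π : List (MvPolynomial X F)) : Prop :=
  ∀ (i : ℕ) (h : i < π.length), PCStep Q (π.take i) π[i]

/-- A PC refutation is a PC proof whose last line is `1`. -/
def IsPCRefutation (Q : Set (MvPolynomial X F)) (π : List (MvPolynomial X F)) : Prop :=
  IsPCProof Q π ∧ π.getLast? = some 1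

/-- An OFPC refutation of `Q`: a sequence of ordered formulas which compute, line by line, the
polynomials of a PC refutation of `Q`. -/
def IsOFPCRefutation (ord : LinearOrder X) (Q : Set (MvPolynomial X F))
    (φs : List (NCFormula F X)) : Prop :=
  ∃ π : List (MvPolynomial X F), IsPCRefutation Q π ∧ List.Forall₂ (OrderedComputes ord) φs π

/-- The size of an OFPC proof: the total size of its formulas. -/
def ofpcSize (φs : List (NCFormula F X)) : ℕ := (φs.map NCFormula.size).sum

end PC

/-! ### The functional pigeonhole principle -/

/-- The (negation of the) functional `m` to `n` pigeonhole principle, as a set of polynomials over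
`F`; the variable `(i, k)` says that pigeon `i` sits in hole `k`. -/
def FPHP (F : Type*) [Field F] (m n : ℕ) : Set (MvPolynomial (Fin m × Fin n) F) :=
  {p | (∃ i : Fin m, p = ∏ k : Fin n, (1 - MvPolynomial.X (i, k))) ∨
       (∃ i : Fin m, ∃ k l : Fin n, k < l ∧
          p = MvPolynomial.X (i, k) * MvPolynomial.X (i, l)) ∨
       (∃ i j : Fin m, i < j ∧ ∃ k : Fin n,
          p = MvPolynomial.X (i, k) * MvPolynomial.X (j, k))}

/-! ### CNF formulas, resolution, and simulations -/

/-- A literal: `(x, true)` is the positive literal `x`, `(x, false)` is the literal `¬ x`. -/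
abbrev Literal (X : Type*) := X × Bool

/-- A clause is a finite set of literals, read as their disjunction. -/
abbrev Clause (X : Type*) := Finset (Literal X)

/-- A CNF formula is a finite set of clauses, read as their conjunction. -/
abbrev CNF (X : Type*) := Finset (Clause X)

section Resolution

variable {X : Type*} [DecidableEq X]

/-- `C` is a clause of `K`, or is obtained from two clauses in `prev` by the resolution rule. -/
def ResStep (K : CNF X) (prev : List (Clause X)) (C : Clause X) : Prop :=
  C ∈ K ∨
  ∃ x : X, ∃ A ∈ prev, ∃ B ∈ prev, (x, true) ∈ A ∧ (x, false) ∈ B ∧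
    C = A.erase (x, true) ∪ B.erase (x, false)

/-- A resolution refutation of `K`: a sequence of clauses, each justified from the preceding ones,
that ends with the empty clause. -/
def IsResRefutation (K : CNF X) (π : List (Clause X)) : Prop :=
  (∀ (i : ℕ) (h : i < π.length), ResStep K (π.take i) π[i]) ∧ π.getLast? = some ∅

end Resolution

/-- The polynomial translation of a clause: the product of `x - 1` over its positive literals `x`
and of `x - 0` over its negative literals `¬ x`. -/
def clausePoly (F : Type*) {X : Type*} [Field F] (C : Clause X) : MvPolynomial X F :=
  ∏ l ∈ C, (MvPolynomial.X l.1 - MvPolynomial.C (if l.2 then 1 else 0))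

/-- The polynomial translation of a CNF formula. -/
def cnfPolys (F : Type*) {X : Type*} [Field F] (K : CNF X) : Set (MvPolynomial X F) :=
  {p | ∃ C ∈ K, p = clausePoly F C}

/-- A refutation system for CNF formulas over the variables `x₀, x₁, …`, seen through its sizes:
`P K s` says that `K` has a refutation of size `s` in the system. -/
abbrev RefSystem := CNF ℕ → ℕ → Prop

/-- Resolution; the size of a refutation is its number of clauses. -/
def resolution : RefSystem := fun K s =>
  ∃ π : List (Clause ℕ), IsResRefutation K π ∧ π.length = s

/-- OFPC over `F` with respect to the order `ord` on the variables, refuting polynomial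
translations of CNF formulas. -/
def ofpc (F : Type*) [Field F] (ord : LinearOrder ℕ) : RefSystem := fun K s =>
  ∃ φs : List (NCFormula F ℕ), IsOFPCRefutation ord (cnfPolys F K) φs ∧ ofpcSize φs = s

/-- `P₂` polynomially simulates `P₁`. -/
def PolySimulates (P₂ P₁ : RefSystem) : Prop :=
  ∃ p : Polynomial ℕ, ∀ (K : CNF ℕ) (s : ℕ), P₁ K s → ∃ t : ℕ, t ≤ p.eval s ∧ P₂ K t

/-- `P₂` is strictly stronger than `P₁`. -/
def StrictlyStronger (P₂ P₁ : RefSystem) : Prop :=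
  PolySimulates P₂ P₁ ∧ ¬ PolySimulates P₁ P₂

end

end OrderedPC

/-! Upper bound for the pigeonhole principle. Modulo the axioms, the product of `1 + t * x` over all
variables of `n + 1` pigeons is computed in two ways. Grouped by pigeons, every factor becomes `1 +
t`, so the product is `(1 + t) ^ (n + 1)`. Grouped by holes, every factor becomes `1 + t * ∑ x`, so
the product has degree at most `n` in `t`. With `n + 2` distinct field elements `t r` there are
weights that annihilate the powers up to `n` and send `(1 + t) ^ (n + 1)` to `1` (`exists_weights`).
The weighted product is then derivable by holes (`derives_weightedProd`), and its difference from
`1` is derivable by pigeons (`sumOf_prod_genProd_sub`), which gives `1`.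

All lines are sums of polynomially many products of univariate affine polynomials. Such a product
has a linear size ordered formula for every variable order, because its factors may be sorted
(`IsProd.small`). Clause polynomials are of this kind as well, so resolution is simulated step by
step (`derives_resolvent`).

For the separation, resolution needs exponential size on the same principle. A critical assignment
fills every hole and leaves out one pigeon. The set of left out pigeons over the assignments that
falsify a clause has at most one element for axioms, is subadditive under resolution and is
everything for the empty clause. Hence some clause has a medium value
(`exists_intermediate_clause`), and exchanging pigeons shows that many pairs of a pigeon and a hole
satisfy that clause (`card_critical_mul_le`). A greedy matching of half of the pigeons satisfies all
but a fraction `(35 / 36) ^ (3 * c)` of the clauses with many such pairs (`exists_matching`). The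
medium clause found relative to this matching is large and unsatisfied, so the refutation is
exponentially long. -/

namespace OrderedPC

open MvPolynomial

/-! ### Writing monomials in order. -/

section Bracket

variable {F σ : Type*} [Field F]

/-- The map `⟦·⟧` as a linear map. -/
noncomputable def bracketLin (F : Type*) {σ : Type*} [Field F] (ord : LinearOrder σ) :
    MvPolynomial σ F →ₗ[F] FreeAlgebra F σ :=
  (basisMonomials σ F).constr F (orderedMonomial F ord)

theorem bracketLin_apply (ord : LinearOrder σ) (f : MvPolynomial σ F) :
    bracketLin F ord f = bracket ord f := by
  rw [bracketLin, Module.Basis.constr_apply]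
  rfl

theorem bracketLin_monomial (ord : LinearOrder σ) (d : σ →₀ ℕ) (a : F) :
    bracketLin F ord (monomial d a) = a • orderedMonomial F ord d := by
  have h : monomial d a = a • (basisMonomials σ F d) := by
    simp [smul_monomial]
  rw [h, map_smul, bracketLin, Module.Basis.constr_basis]

theorem bracket_add (ord : LinearOrder σ) (f g : MvPolynomial σ F) :
    bracket ord (f + g) = bracket ord f + bracket ord g := by
  simp only [← bracketLin_apply, map_add]

theorem bracket_C_mul (ord : LinearOrder σ) (a : F) (f : MvPolynomial σ F) :
    bracket ord (C a * f) = algebraMap F _ a * bracket ord f := by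
  rw [← smul_eq_C_mul, ← bracketLin_apply, map_smul, bracketLin_apply, Algebra.smul_def]

theorem orderedMonomial_zero (ord : LinearOrder σ) :
    orderedMonomial F ord (0 : σ →₀ ℕ) = 1 := by
  simp [orderedMonomial]

theorem bracket_C (ord : LinearOrder σ) (a : F) :
    bracket ord (C a : MvPolynomial σ F) = algebraMap F _ a := by
  rw [← bracketLin_apply, C_apply, bracketLin_monomial, orderedMonomial_zero,
    Algebra.algebraMap_eq_smul_one]

/-- A variable that precedes all variables of a monomial comes first when the product is
written in order. -/
theorem orderedMonomial_single_add (ord : LinearOrder σ) (v : σ) (d : σ →₀ ℕ)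
    (h : ∀ w ∈ d.support, ord.le v w) :
    orderedMonomial F ord (Finsupp.single v 1 + d) =
      FreeAlgebra.ι F v * orderedMonomial F ord d := by
  let := ord
  have h1 : Finsupp.toMultiset (Finsupp.single v 1 + d) = v ::ₘ Finsupp.toMultiset d := by
    rw [map_add, Finsupp.toMultiset_single, one_smul, Multiset.singleton_add]
  unfold orderedMonomial
  rw [h1, Multiset.sort_cons]
  · simp
  · intro b hb
    exact h b (by simpa using hb)

/-- A sorted word with letters at least `v` stays sorted when `v` is prepended. The inequality is
weak, so `v` may occur in `g`. -/
theorem bracket_X_mul (ord : LinearOrder σ) (v : σ) (g : MvPolynomial σ F)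
    (h : ∀ w ∈ g.vars, ord.le v w) :
    bracket ord (X v * g) = FreeAlgebra.ι F v * bracket ord g := by
  conv_lhs => rw [← support_sum_monomial_coeff g, Finset.mul_sum]
  rw [← bracketLin_apply, map_sum, bracket, Finset.mul_sum]
  refine Finset.sum_congr rfl fun d hd => ?_
  rw [X, monomial_mul, one_mul, bracketLin_monomial, orderedMonomial_single_add, mul_smul_comm]
  intro w hw
  exact h w ((mem_vars_iff_mem_support w).2 ⟨d, hd, hw⟩)

theorem bracket_X (ord : LinearOrder σ) (v : σ) :
    bracket ord (X v : MvPolynomial σ F) = FreeAlgebra.ι F v := by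
  have h := bracket_X_mul (F := F) ord v 1 (by simp)
  rw [mul_one, ← C_1, bracket_C] at h
  simpa using h

end Bracket

/-! ### Small ordered formulas and products of affine polynomials. -/

section Small

variable {F σ : Type*} [Field F]

/-- `f` has an ordered formula of size at most `B`. -/
def Small (ord : LinearOrder σ) (B : ℕ) (f : MvPolynomial σ F) : Prop :=
  ∃ φ : NCFormula F σ, OrderedComputes ord φ f ∧ φ.size ≤ B

theorem Small.mono {ord : LinearOrder σ} {B B' : ℕ} {f : MvPolynomial σ F}
    (h : Small ord B f) (hB : B ≤ B') : Small ord B' f :=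
  let ⟨φ, h1, h2⟩ := h
  ⟨φ, h1, h2.trans hB⟩

theorem OrderedComputes.const (ord : LinearOrder σ) (a : F) :
    OrderedComputes ord (.const a) (C a : MvPolynomial σ F) := by
  refine ⟨⟨C a, ?_⟩, ?_⟩ <;> simp [NCFormula.eval, bracket_C]

theorem OrderedComputes.var (ord : LinearOrder σ) (v : σ) :
    OrderedComputes ord (.var v) (X v : MvPolynomial σ F) := by
  refine ⟨⟨X v, ?_⟩, ?_⟩ <;> simp [NCFormula.eval, bracket_X]

theorem OrderedComputes.add {ord : LinearOrder σ} {φ ψ : NCFormula F σ} {f g : MvPolynomial σ F}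
    (hf : OrderedComputes ord φ f) (hg : OrderedComputes ord ψ g) :
    OrderedComputes ord (.add φ ψ) (f + g) := by
  have h : (NCFormula.add φ ψ).eval = bracket ord (f + g) := by
    rw [bracket_add, ← hf.2, ← hg.2, NCFormula.eval]
  exact ⟨⟨⟨_, h.symm⟩, hf.1, hg.1⟩, h⟩

/-- The map `⟦·⟧` is linear but not multiplicative, so product gates need `hfg`. -/
theorem OrderedComputes.mul {ord : LinearOrder σ} {φ ψ : NCFormula F σ} {f g : MvPolynomial σ F}
    (hf : OrderedComputes ord φ f) (hg : OrderedComputes ord ψ g)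
    (hfg : bracket ord (f * g) = bracket ord f * bracket ord g) :
    OrderedComputes ord (.mul φ ψ) (f * g) := by
  have h : (NCFormula.mul φ ψ).eval = bracket ord (f * g) := by
    rw [hfg, ← hf.2, ← hg.2, NCFormula.eval]
  exact ⟨⟨⟨_, h.symm⟩, hf.1, hg.1⟩, h⟩

theorem Small.zero (ord : LinearOrder σ) {B : ℕ} (hB : 1 ≤ B) :
    Small ord B (0 : MvPolynomial σ F) :=
  ⟨.const 0, by simpa using OrderedComputes.const (σ := σ) ord (0 : F), hB⟩

theorem Small.add {ord : LinearOrder σ} {B B' : ℕ} {f g : MvPolynomial σ F}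
    (hf : Small ord B f) (hg : Small ord B' g) : Small ord (B + B' + 1) (f + g) := by
  obtain ⟨φ, h1, h2⟩ := hf
  obtain ⟨ψ, h3, h4⟩ := hg
  exact ⟨.add φ ψ, h1.add h3, by simp only [NCFormula.size]; omega⟩

theorem Small.list_sum {ord : LinearOrder σ} {b : ℕ} (l : List (MvPolynomial σ F))
    (h : ∀ f ∈ l, Small ord b f) : Small ord (l.length * (b + 1) + 1) l.sum := by
  induction l with
  | nil => exact Small.zero ord (by simp)
  | cons f l ih =>
    rw [List.sum_cons]
    refine ((h f (by simp)).add (ih fun g hg => h g (by simp [hg]))).mono ?_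
    simp only [List.length_cons]
    ring_nf
    omega

/-- The product of the univariate affine polynomials `a + b * x` over the entries `(x, a, b)`
of a list. -/
noncomputable def affineProd (l : List (σ × F × F)) : MvPolynomial σ F :=
  (l.map fun p => C p.2.1 + C p.2.2 * X p.1).prod

@[simp] theorem affineProd_nil : affineProd ([] : List (σ × F × F)) = 1 := rfl

@[simp] theorem affineProd_cons (p : σ × F × F) (l : List (σ × F × F)) :
    affineProd (p :: l) = (C p.2.1 + C p.2.2 * X p.1) * affineProd l := by
  simp [affineProd]

theorem affineProd_append (l l' : List (σ × F × F)) :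
    affineProd (l ++ l') = affineProd l * affineProd l' := by
  simp [affineProd]

theorem affineProd_perm {l l' : List (σ × F × F)} (h : l.Perm l') :
    affineProd l = affineProd l' :=
  (h.map _).prod_eq

theorem vars_affineProd (l : List (σ × F × F)) {w : σ} (hw : w ∈ (affineProd l).vars) :
    ∃ p ∈ l, p.1 = w := by
  classical
  induction l with
  | nil => simp at hw
  | cons p l ih =>
    rw [affineProd_cons] at hw
    rcases Finset.mem_union.1 (vars_mul _ _ hw) with h | h
    · rcases Finset.mem_union.1 (vars_add_subset _ _ h) with h | h
      · simp at h
      · rcases Finset.mem_union.1 (vars_mul _ _ h) with h | h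
        · simp at h
        · exact ⟨p, by simp, by simpa [eq_comm] using h⟩
    · obtain ⟨q, hq, rfl⟩ := ih h
      exact ⟨q, by simp [hq], rfl⟩

/-- Each factor `a + b * v` is multiplied on the left of factors with variables at least `v`, so
`bracket_X_mul` applies; it costs six nodes. -/
theorem small_affineProd_of_pairwise (ord : LinearOrder σ) (c : F) (l : List (σ × F × F))
    (hl : l.Pairwise fun p q => ord.le p.1 q.1) :
    Small ord (6 * l.length + 1) (C c * affineProd l) := by
  induction l with
  | nil => exact ⟨.const c, by simpa using OrderedComputes.const (σ := σ) ord c,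
      by simp [NCFormula.size]⟩
  | cons p l ih =>
    obtain ⟨hp, hl⟩ := List.pairwise_cons.1 hl
    obtain ⟨φ, h1, h2⟩ := ih hl
    obtain ⟨v, a, b⟩ := p
    have hb := (OrderedComputes.const ord b).mul (OrderedComputes.var (F := F) ord v)
      (by rw [bracket_C_mul, bracket_C])
    have ha := (OrderedComputes.const ord a).add hb
    have hv : ∀ w ∈ (C c * affineProd l).vars, ord.le v w := by
      classical
      intro w hw
      rcases Finset.mem_union.1 (vars_mul _ _ hw) with h | h
      · simp at h
      · obtain ⟨q, hq, rfl⟩ := vars_affineProd l h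
        exact hp q hq
    refine ⟨.mul (.add (.const a) (.mul (.const b) (.var v))) φ, ?_, ?_⟩
    · rw [affineProd_cons, mul_left_comm]
      refine ha.mul h1 ?_
      generalize C c * affineProd l = g at hv
      rw [add_mul, bracket_add, bracket_add, add_mul, bracket_C_mul, bracket_C, mul_assoc,
        bracket_C_mul, bracket_C_mul, bracket_X_mul ord v _ hv, bracket_X, mul_assoc]
    · simp only [NCFormula.size, List.length_cons]
      omega

/-- `f` is a scalar multiple of a product of at most `D` univariate affine polynomials. -/
def IsProd (D : ℕ) (f : MvPolynomial σ F) : Prop :=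
  ∃ (c : F) (l : List (σ × F × F)), l.length ≤ D ∧ f = C c * affineProd l

/-- Products of univariate affine polynomials have small ordered formulas for every order on the
variables. -/
theorem IsProd.small {D : ℕ} {f : MvPolynomial σ F} (h : IsProd D f) (ord : LinearOrder σ) :
    Small ord (6 * D + 1) f := by
  obtain ⟨c, l, hl, rfl⟩ := h
  let := ord
  -- The commutative product does not depend on the order of its factors, so they may be sorted by
  -- variable.
  have hp := l.mergeSort_perm fun p q => decide (p.1 ≤ q.1)
  rw [← affineProd_perm hp]
  refine (small_affineProd_of_pairwise ord c _ ?_).mono (by rw [hp.length_eq]; omega)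
  have := List.pairwise_mergeSort (le := fun p q : σ × F × F => decide (p.1 ≤ q.1))
    (fun a b c h1 h2 => by simp only [decide_eq_true_eq] at *; exact h1.trans h2)
    (fun a b => by simpa using le_total a.1 b.1) l
  exact this.imp fun h => by simpa using h

theorem IsProd.mono {D D' : ℕ} {f : MvPolynomial σ F} (h : IsProd D f) (hD : D ≤ D') :
    IsProd D' f :=
  let ⟨c, l, h1, h2⟩ := h
  ⟨c, l, h1.trans hD, h2⟩

theorem IsProd.of_C (c : F) : IsProd 0 (C c : MvPolynomial σ F) := ⟨c, [], by simp, by simp⟩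

theorem IsProd.one : IsProd 0 (1 : MvPolynomial σ F) := by
  simpa using IsProd.of_C (σ := σ) (1 : F)

theorem IsProd.affine (a b : F) (v : σ) :
    IsProd 1 (C a + C b * X v) :=
  ⟨1, [(v, a, b)], by simp, by simp⟩

theorem IsProd.of_X (v : σ) : IsProd 1 (X v : MvPolynomial σ F) := by
  simpa using IsProd.affine (0 : F) 1 v

theorem IsProd.mul {D D' : ℕ} {f g : MvPolynomial σ F} (hf : IsProd D f) (hg : IsProd D' g) :
    IsProd (D + D') (f * g) := by
  obtain ⟨c, l, h1, rfl⟩ := hf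
  obtain ⟨c', l', h2, rfl⟩ := hg
  refine ⟨c * c', l ++ l', by simp; omega, ?_⟩
  rw [affineProd_append, C_mul]
  ring

theorem IsProd.list_prod {D : ℕ} (l : List (MvPolynomial σ F)) (h : ∀ f ∈ l, IsProd D f) :
    IsProd (l.length * D) l.prod := by
  induction l with
  | nil => simpa using IsProd.one
  | cons f l ih =>
    rw [List.prod_cons]
    refine ((h f (by simp)).mul (ih fun g hg => h g (by simp [hg]))).mono ?_
    simp only [List.length_cons]
    ring_nf
    omega

end Small

end OrderedPC
namespace OrderedPC

open MvPolynomial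

/-! ### Size-bounded derivability in polynomial calculus. -/

section Derivability

variable {F σ : Type*} [Field F]

theorem PCStep.mono {Q : Set (MvPolynomial σ F)} {l l' : List (MvPolynomial σ F)}
    {p : MvPolynomial σ F} (h : PCStep Q l p) (hl : ∀ q ∈ l, q ∈ l') : PCStep Q l' p := by
  rcases h with h | h | ⟨x, q, hq, h⟩ | ⟨a, b, q, hq, r, hr, h⟩
  · exact Or.inl h
  · exact Or.inr (Or.inl h)
  · exact Or.inr (Or.inr (Or.inl ⟨x, q, hl q hq, h⟩))
  · exact Or.inr (Or.inr (Or.inr ⟨a, b, q, hl q hq, r, hl r hr, h⟩))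

theorem IsPCProof.concat {Q : Set (MvPolynomial σ F)} {π : List (MvPolynomial σ F)}
    {p : MvPolynomial σ F} (h : IsPCProof Q π) (hp : PCStep Q π p) : IsPCProof Q (π ++ [p]) := by
  intro i hi
  rw [List.length_append, List.length_singleton] at hi
  rcases Nat.lt_succ_iff_lt_or_eq.1 hi with h1 | rfl
  · rw [List.take_append_of_le_length h1.le, List.getElem_append_left h1]
    exact h i h1
  · simpa using hp

/-- Every polynomial calculus proof with lines of ordered formula size at most `B` which contains
`H` can be extended by at most `L` lines of size at most `B` to a proof which contains `G`. -/
def Derives (Q : Set (MvPolynomial σ F)) (ord : LinearOrder σ) (B : ℕ)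
    (H : Set (MvPolynomial σ F)) (L : ℕ) (G : Set (MvPolynomial σ F)) : Prop :=
  ∀ π : List (MvPolynomial σ F), IsPCProof Q π → (∀ f ∈ π, Small ord B f) → (∀ f ∈ H, f ∈ π) →
    ∃ ρ : List (MvPolynomial σ F), IsPCProof Q (π ++ ρ) ∧ (∀ f ∈ ρ, Small ord B f) ∧
      ρ.length ≤ L ∧ ∀ f ∈ G, f ∈ π ++ ρ

variable {Q : Set (MvPolynomial σ F)} {ord : LinearOrder σ} {B L L' : ℕ}
  {H H' G G' : Set (MvPolynomial σ F)}

theorem Derives.mono (h : Derives Q ord B H L G) (hH : H ⊆ H') (hL : L ≤ L') (hG : G' ⊆ G) :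
    Derives Q ord B H' L' G' := by
  intro π h1 h2 h3
  obtain ⟨ρ, h4, h5, h6, h7⟩ := h π h1 h2 fun f hf => h3 f (hH hf)
  exact ⟨ρ, h4, h5, h6.trans hL, fun f hf => h7 f (hG hf)⟩

theorem Derives.of_subset (h : G ⊆ H) : Derives Q ord B H L G := by
  intro π h1 _ h3
  exact ⟨[], by simpa using h1, by simp, by simp, fun f hf => by simpa using h3 f (h hf)⟩

theorem Derives.trans (h : Derives Q ord B H L G) (h' : Derives Q ord B (H ∪ G) L' G') :
    Derives Q ord B H (L + L') (G ∪ G') := by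
  intro π h1 h2 h3
  obtain ⟨ρ, h4, h5, h6, h7⟩ := h π h1 h2 h3
  obtain ⟨ρ', h8, h9, h10, h11⟩ := h' (π ++ ρ) h4
    (fun f hf => (List.mem_append.1 hf).elim (h2 f) (h5 f))
    (fun f hf => hf.elim (fun hf => List.mem_append_left _ (h3 f hf)) (h7 f))
  rw [List.append_assoc] at h8 h11
  refine ⟨ρ ++ ρ', h8, fun f hf => (List.mem_append.1 hf).elim (h5 f) (h9 f),
    by simp; omega, fun f hf => hf.elim (fun hf => ?_) (h11 f)⟩
  have := h7 f hf
  simp only [List.mem_append] at this ⊢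
  tauto

/-- Composition of derivations, forgetting the intermediate lines. -/
theorem Derives.trans' (h : Derives Q ord B H L G) (h' : Derives Q ord B (H ∪ G) L' G') :
    Derives Q ord B H (L + L') G' :=
  (h.trans h').mono subset_rfl le_rfl Set.subset_union_right

theorem Derives.step {p : MvPolynomial σ F} {l : List (MvPolynomial σ F)}
    (hl : ∀ q ∈ l, q ∈ H) (h : PCStep Q l p) (hp : Small ord B p) :
    Derives Q ord B H 1 {p} := by
  intro π h1 h2 h3
  refine ⟨[p], h1.concat (h.mono fun q hq => h3 q (hl q hq)), by simpa using hp, by simp, ?_⟩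
  rintro f rfl
  simp

theorem Derives.hyp {p : MvPolynomial σ F} (hQ : p ∈ Q) (hp : Small ord B p) :
    Derives Q ord B H 1 {p} :=
  Derives.step (l := []) (by simp) (Or.inl hQ) hp

theorem Derives.X_mul {p : MvPolynomial σ F} (v : σ) (h : p ∈ H) (hp : Small ord B (X v * p)) :
    Derives Q ord B H 1 {X v * p} :=
  Derives.step (l := [p]) (by simpa using h) (Or.inr (Or.inr (Or.inl ⟨v, p, by simp, rfl⟩))) hp

theorem Derives.linear {p q r : MvPolynomial σ F} (a b : F) (hp : p ∈ H) (hq : q ∈ H)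
    (hr : r = C a * p + C b * q) (h : Small ord B r) :
    Derives Q ord B H 1 {r} :=
  Derives.step (l := [p, q]) (by simp [hp, hq])
    (Or.inr (Or.inr (Or.inr ⟨a, b, p, by simp, q, by simp, hr⟩))) h

theorem Derives.list {α : Type*} (l : List α) (G : α → Set (MvPolynomial σ F))
    (h : ∀ a ∈ l, Derives Q ord B H L (G a)) :
    Derives Q ord B H (l.length * L) {f | ∃ a ∈ l, f ∈ G a} := by
  induction l with
  | nil => exact Derives.of_subset (by simp)
  | cons a l ih =>
    refine ((h a (by simp)).trans ((ih fun b hb => h b (by simp [hb])).mono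
      Set.subset_union_left le_rfl subset_rfl)).mono subset_rfl ?_ ?_
    · simp only [List.length_cons]
      ring_nf
      omega
    · rintro f ⟨b, hb, hf⟩
      rcases List.mem_cons.1 hb with rfl | hb
      · exact Or.inl hf
      · exact Or.inr ⟨b, hb, hf⟩

/-- A sum of polynomials which are derivable from `H` is derivable from `H`. -/
theorem Derives.list_sum {b : ℕ} (h0 : (0 : MvPolynomial σ F) ∈ H)
    (l : List (MvPolynomial σ F))
    (h : ∀ f ∈ l, Small ord b f ∧ Derives Q ord B H L {f}) (hB : l.length * (b + 1) + 1 ≤ B) :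
    Derives Q ord B H (l.length * (L + 1)) {l.sum} := by
  induction l with
  | nil => exact Derives.of_subset (by simpa using h0)
  | cons f l ih =>
    have hle : l.length * (b + 1) + 1 ≤ B := by
      refine le_trans ?_ hB
      gcongr
      simp
    have h1 := ih (fun g hg => h g (by simp [hg])) hle
    have h2 : Derives Q ord B (H ∪ {l.sum}) L {f} :=
      (h f (by simp)).2.mono Set.subset_union_left le_rfl subset_rfl
    have h3 : Derives Q ord B (H ∪ ({l.sum} ∪ {f})) 1 {(f :: l).sum} :=
      Derives.linear (p := f) (q := l.sum) 1 1 (by simp) (by simp) (by simp)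
        ((Small.list_sum _ fun g hg => (h g hg).1).mono hB)
    refine ((h1.trans h2).trans' h3).mono subset_rfl ?_ subset_rfl
    simp only [List.length_cons]
    ring_nf
    omega

/-- A line may be multiplied by a product of univariate affine polynomials. -/
theorem Derives.mul_affineProd (l : List (σ × F × F)) {D : ℕ} {f : MvPolynomial σ F}
    (hf : IsProd D f) (hH : f ∈ H) (hB : 6 * (D + l.length) + 1 ≤ B) :
    Derives Q ord B H (2 * l.length) {f * affineProd l} := by
  induction l generalizing D f H with
  | nil => exact Derives.of_subset (by simpa using hH)
  | cons p l ih =>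
    obtain ⟨v, a, b⟩ := p
    rw [List.length_cons] at hB
    have h1 : Derives Q ord B H 1 {X v * f} :=
      Derives.X_mul v hH ((((IsProd.of_X v).mul hf).small ord).mono (by omega))
    have hf' : IsProd (D + 1) (f * (C a + C b * X v)) := hf.mul (IsProd.affine a b v)
    have h2 : Derives Q ord B (H ∪ {X v * f}) 1 {f * (C a + C b * X v)} :=
      Derives.linear a b (p := f) (q := X v * f) (by simp [hH]) (by simp) (by ring)
        ((hf'.small ord).mono (by omega))
    have h3 := ih (H := H ∪ {f * (C a + C b * X v)}) hf' (by simp) (by omega)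
    refine ((h1.trans' h2).trans' h3).mono subset_rfl ?_ ?_
    · rw [List.length_cons]
      omega
    · rw [affineProd_cons, mul_assoc]

theorem Derives.mul_isProd {D D' : ℕ} {f g : MvPolynomial σ F}
    (hf : IsProd D f) (hg : IsProd D' g) (hH : f ∈ H) (hB : 6 * (D + D') + 1 ≤ B) :
    Derives Q ord B H (2 * D' + 1) {f * g} := by
  obtain ⟨c, l, hl, rfl⟩ := hg
  have hf' : IsProd D (C c * f) := by simpa using (IsProd.of_C c).mul hf
  have h1 : Derives Q ord B H 1 {C c * f} :=
    Derives.linear c 0 (p := f) (q := f) hH hH (by simp) ((hf'.small ord).mono (by omega))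
  have h2 := Derives.mul_affineProd (Q := Q) (ord := ord) (B := B) (H := H ∪ {C c * f}) l hf'
    (by simp) (by omega)
  refine (h1.trans' h2).mono subset_rfl (by omega) ?_
  rw [show f * (C c * affineProd l) = C c * f * affineProd l by ring]

/-- A derivation of `1` gives a refutation over ordered formulas. -/
theorem Derives.exists_refutation (h : Derives Q ord B ∅ L {1}) (hB : 1 ≤ B) :
    ∃ φs : List (NCFormula F σ), IsOFPCRefutation ord Q φs ∧ ofpcSize φs ≤ (L + 1) * B := by
  have hs : Small ord B (1 : MvPolynomial σ F) := (IsProd.one.small ord).mono hB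
  obtain ⟨π, h1, h2, h3, h4⟩ := h [] (by intro i hi; simp at hi) (by simp) (by simp)
  simp only [List.nil_append, Set.mem_singleton_iff, forall_eq] at h1 h4
  have hπ : ∀ f ∈ π ++ [1], Small ord B f := by
    intro f hf
    rcases List.mem_append.1 hf with hf | hf
    · exact h2 f hf
    · rw [List.mem_singleton.1 hf]
      exact hs
  have key : ∀ l : List (MvPolynomial σ F), (∀ f ∈ l, Small ord B f) →
      ∃ φs, List.Forall₂ (OrderedComputes ord) φs l ∧ ofpcSize φs ≤ l.length * B := by
    intro l hl
    induction l with
    | nil => exact ⟨[], .nil, by simp [ofpcSize]⟩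
    | cons f l ih =>
      obtain ⟨φs, h5, h6⟩ := ih fun g hg => hl g (by simp [hg])
      obtain ⟨φ, h7, h8⟩ := hl f (by simp)
      refine ⟨φ :: φs, .cons h7 h5, ?_⟩
      simp only [ofpcSize, List.map_cons, List.sum_cons, List.length_cons] at h6 ⊢
      linarith
  obtain ⟨φs, h5, h6⟩ := key _ hπ
  -- The line `1` is repeated at the end, since a refutation must end with it; this accounts for `L
  -- + 1`.
  refine ⟨φs, ⟨π ++ [1], ⟨h1.concat (Or.inr (Or.inr (Or.inr ⟨1, 0, 1, h4, 1, h4, by simp⟩))),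
    by simp⟩, h5⟩, h6.trans ?_⟩
  gcongr
  simpa using h3

end Derivability

end OrderedPC
namespace OrderedPC

open MvPolynomial

/-! ### Sums with few terms. -/

section SumOf

/-- `f` is a sum of at most `R` elements with the property `P`. -/
def SumOf {M : Type*} [AddCommMonoid M] (P : M → Prop) (R : ℕ) (f : M) : Prop :=
  ∃ l : List M, l.length ≤ R ∧ f = l.sum ∧ ∀ h ∈ l, P h

variable {M : Type*} [AddCommMonoid M] {P P' : M → Prop} {R R' : ℕ} {f g : M}

theorem SumOf.mono (h : SumOf P R f) (hP : ∀ x, P x → P' x) (hR : R ≤ R') : SumOf P' R' f :=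
  let ⟨l, h1, h2, h3⟩ := h
  ⟨l, h1.trans hR, h2, fun x hx => hP x (h3 x hx)⟩

theorem SumOf.zero : SumOf P 0 (0 : M) := ⟨[], by simp⟩

theorem SumOf.single (h : P f) : SumOf P 1 f := ⟨[f], by simpa⟩

theorem SumOf.add (hf : SumOf P R f) (hg : SumOf P R' g) : SumOf P (R + R') (f + g) := by
  obtain ⟨l, h1, rfl, h3⟩ := hf
  obtain ⟨l', h4, rfl, h6⟩ := hg
  exact ⟨l ++ l', by simp; omega, by simp,
    fun x hx => (List.mem_append.1 hx).elim (h3 x) (h6 x)⟩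

theorem SumOf.list_sum (l : List M) (h : ∀ x ∈ l, P x) : SumOf P l.length l.sum :=
  ⟨l, le_rfl, rfl, h⟩

theorem SumOf.finset_sum {ι : Type*} (s : Finset ι) (F : ι → M)
    (h : ∀ i ∈ s, SumOf P R (F i)) : SumOf P (s.card * R) (∑ i ∈ s, F i) := by
  classical
  induction s using Finset.induction_on with
  | empty => simpa using SumOf.zero
  | insert a s ha ih =>
    rw [Finset.sum_insert ha, Finset.card_insert_of_notMem ha, Nat.succ_mul, add_comm]
    exact (ih fun i hi => h i (by simp [hi])).add (h a (by simp)) |>.mono (fun _ h => h) le_rfl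
      |> fun h => by simpa [add_comm] using h

theorem SumOf.mul_left {A : Type*} [CommRing A] {P P' : A → Prop} {f : A} (g : A)
    (hf : SumOf P R f) (h : ∀ x, P x → P' (g * x)) : SumOf P' R (g * f) := by
  obtain ⟨l, h1, rfl, h3⟩ := hf
  refine ⟨l.map (g * ·), by simpa using h1, by rw [List.sum_map_mul_left]; simp, ?_⟩
  simpa using fun x hx => h x (h3 x hx)

end SumOf

/-! ### The product of `1 + t * x` modulo the pigeonhole axioms. -/

section PigeonholeUpper

variable {F σ : Type*} [Field F]

theorem SumOf.small {ord : LinearOrder σ} {b R : ℕ} {f : MvPolynomial σ F}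
    (h : SumOf (Small ord b) R f) : Small ord (R * (b + 1) + 1) f := by
  obtain ⟨l, h1, rfl, h3⟩ := h
  refine (Small.list_sum l h3).mono ?_
  gcongr

theorem SumOf.derives {Q H : Set (MvPolynomial σ F)} {ord : LinearOrder σ} {b R B L : ℕ}
    {f : MvPolynomial σ F}
    (h : SumOf (fun g => Small ord b g ∧ Derives Q ord B H L {g}) R f) (h0 : 0 ∈ H)
    (hB : R * (b + 1) + 1 ≤ B) : Derives Q ord B H (R * (L + 1)) {f} := by
  obtain ⟨l, h1, rfl, h3⟩ := h
  refine (Derives.list_sum h0 l h3 (le_trans ?_ hB)).mono subset_rfl ?_ subset_rfl <;> gcongr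

/-- `h` is a product of an element of `Q` and a product of affine polynomials. -/
def AxiomMultiple (Q : Set (MvPolynomial σ F)) (D : ℕ) (h : MvPolynomial σ F) : Prop :=
  ∃ q ∈ Q, ∃ g, IsProd D q ∧ IsProd D g ∧ h = q * g

variable {Q : Set (MvPolynomial σ F)}

theorem AxiomMultiple.mono {D D' : ℕ} {h : MvPolynomial σ F} (H : AxiomMultiple Q D h)
    (hD : D ≤ D') : AxiomMultiple Q D' h :=
  let ⟨q, hq, g, h1, h2, h3⟩ := H
  ⟨q, hq, g, h1.mono hD, h2.mono hD, h3⟩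

theorem AxiomMultiple.mul {D D' : ℕ} {g h : MvPolynomial σ F} (hg : IsProd D' g)
    (H : AxiomMultiple Q D h) : AxiomMultiple Q (D + D') (g * h) := by
  obtain ⟨q, hq, g', h1, h2, rfl⟩ := H
  exact ⟨q, hq, g' * g, h1.mono (by omega), h2.mul hg, by ring⟩

theorem AxiomMultiple.small {D : ℕ} {h : MvPolynomial σ F} (H : AxiomMultiple Q D h)
    (ord : LinearOrder σ) : Small ord (12 * D + 1) h := by
  obtain ⟨q, -, g, h1, h2, rfl⟩ := H
  exact ((h1.mul h2).small ord).mono (by omega)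

theorem AxiomMultiple.derives {D B : ℕ} {h : MvPolynomial σ F} (hh : AxiomMultiple Q D h)
    (ord : LinearOrder σ) (H : Set (MvPolynomial σ F)) (hB : 12 * D + 1 ≤ B) :
    Derives Q ord B H (2 * D + 2) {h} := by
  obtain ⟨q, hq, g, h1, h2, rfl⟩ := hh
  have h3 : Derives Q ord B H 1 {q} := Derives.hyp hq ((h1.small ord).mono (by omega))
  exact (h3.trans' (Derives.mul_isProd h1 h2 (by simp) (by omega))).mono subset_rfl (by omega)
    subset_rfl

/-- The product of `1 + t * x` over the variables `x` in a list. -/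
noncomputable def genProd (t : F) (l : List σ) : MvPolynomial σ F :=
  (l.map fun v => 1 + C t * X v).prod

@[simp] theorem genProd_nil (t : F) : genProd t ([] : List σ) = 1 := rfl

@[simp] theorem genProd_cons (t : F) (v : σ) (l : List σ) :
    genProd t (v :: l) = (1 + C t * X v) * genProd t l := by
  simp [genProd]

theorem isProd_genProd (t : F) (l : List σ) : IsProd l.length (genProd t l) := by
  have := IsProd.list_prod (D := 1) (l.map fun v => 1 + C t * X v) (by
    intro f hf
    obtain ⟨v, -, rfl⟩ := List.mem_map.1 hf
    simpa using IsProd.affine 1 t v)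
  simpa [genProd] using this

theorem isProd_prod_genProd (t : F) (ls : List (List σ)) {m : ℕ} (h : ∀ l ∈ ls, l.length ≤ m) :
    IsProd (ls.length * m) (ls.map (genProd t)).prod := by
  have := IsProd.list_prod (D := m) (ls.map (genProd t)) (by
    intro f hf
    obtain ⟨l, hl, rfl⟩ := List.mem_map.1 hf
    exact (isProd_genProd t l).mono (h l hl))
  simpa using this

/-- Removing the factor of `w` leaves the term `X v * X w * (C t * genProd t l)`, a multiple of an
axiom. -/
theorem sumOf_X_mul_genProd_sub_one (t : F) (v : σ) (l : List σ)
    (h : ∀ w ∈ l, X v * X w ∈ Q) :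
    SumOf (AxiomMultiple Q (l.length + 2)) l.length (X v * (genProd t l - 1)) := by
  induction l with
  | nil => simpa using SumOf.zero
  | cons w l ih =>
    have h1 : AxiomMultiple Q (l.length + 1 + 2) (X v * X w * (C t * genProd t l)) :=
      ⟨_, h w (by simp), _, ((IsProd.of_X v).mul (IsProd.of_X w)).mono (by omega),
        ((IsProd.of_C t).mul (isProd_genProd t l)).mono (by omega), rfl⟩
    have h2 := ((ih fun w hw => h w (by simp [hw])).mono (P' := AxiomMultiple Q (l.length + 1 + 2))
      (fun x hx => hx.mono (by omega)) le_rfl).add (SumOf.single h1)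
    rw [genProd_cons, List.length_cons]
    convert h2 using 1
    ring

/-- The product of `1 + t * x` is `1 + t * ∑ x` modulo the products of two distinct variables. -/
theorem sumOf_genProd_sub (t : F) (l : List σ) (h : l.Pairwise fun v w => X v * X w ∈ Q) :
    SumOf (AxiomMultiple Q (l.length + 2)) (l.length * l.length)
      (genProd t l - 1 - C t * (l.map X).sum) := by
  induction l with
  | nil => simpa using SumOf.zero
  | cons v l ih =>
    obtain ⟨h1, h2⟩ := List.pairwise_cons.1 h
    have h3 := (ih h2).add ((sumOf_X_mul_genProd_sub_one t v l h1).mul_left (C t)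
      fun x hx => by simpa using hx.mul (IsProd.of_C t))
    refine (show SumOf _ _ _ by convert h3 using 1; simp; ring : SumOf
      (AxiomMultiple Q (l.length + 2)) (l.length * l.length + l.length) _).mono
      (fun x hx => hx.mono (by simp)) (by simp only [List.length_cons]; ring_nf; omega)

/-- If exactly one variable of the list is `1` then the product of `1 + t * x` is `1 + t`. -/
theorem sumOf_genProd_sub_one_add (t : F) (l : List σ)
    (h : l.Pairwise fun v w => X v * X w ∈ Q) {c : F} (hc : c ≠ 0)
    (hQ : C c * genProd (-1) l ∈ Q) :
    SumOf (AxiomMultiple Q (l.length + 2)) (2 * (l.length * l.length) + 1)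
      (genProd t l - (1 + C t)) := by
  have h1 := sumOf_genProd_sub t l h
  have h2 := (sumOf_genProd_sub (-1) l h).mul_left (P' := AxiomMultiple Q (l.length + 2)) (C t)
      fun x hx => by simpa using hx.mul (IsProd.of_C t)
  have h3 : AxiomMultiple Q (l.length + 2) (C c * genProd (-1) l * C (-t * c⁻¹)) :=
    ⟨_, hQ, _, ((IsProd.of_C c).mul (isProd_genProd (-1) l)).mono (by omega),
      (IsProd.of_C _).mono (by omega), rfl⟩
  -- With `S` the sum of the variables, the three parts are `genProd t l - 1 - t * S`, `t * (genProd
  -- (-1) l - 1 + S)` and `-t * genProd (-1) l`. The factor `c⁻¹` cancels the scalar of the axiom.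
  refine (show SumOf _ _ _ by
    convert (h1.add h2).add (SumOf.single h3) using 1
    have : (C c * C c⁻¹ : MvPolynomial σ F) = 1 := by rw [← C_mul, mul_inv_cancel₀ hc, C_1]
    simp only [C_mul, C_neg, C_1]
    linear_combination (C t * genProd (-1) l) * this).mono (fun _ h => h) (by omega)

/-- The rows are replaced by `1 + t` one at a time; the remaining row products multiply the error of
each replacement. -/
theorem sumOf_prod_genProd_sub (t : F) (rows : List (List σ)) {n : ℕ}
    (hn : ∀ l ∈ rows, l.length ≤ n)
    (h : ∀ l ∈ rows, l.Pairwise fun v w => X v * X w ∈ Q)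
    (hQ : ∀ l ∈ rows, ∃ c : F, c ≠ 0 ∧ C c * genProd (-1) l ∈ Q) :
    SumOf (AxiomMultiple Q (n + 2 + rows.length * n)) (rows.length * (2 * (n * n) + 1))
      ((rows.map (genProd t)).prod - (1 + C t) ^ rows.length) := by
  induction rows with
  | nil => simpa using SumOf.zero
  | cons l rows ih =>
    have hl := hn l (by simp)
    obtain ⟨c, hc, hcQ⟩ := hQ l (by simp)
    have h1 := ((sumOf_genProd_sub_one_add t l (h l (by simp)) hc hcQ).mul_left
      (P' := AxiomMultiple Q (n + 2 + rows.length * n)) (rows.map (genProd t)).prod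
      fun x hx => (hx.mul (isProd_prod_genProd t rows fun l' h' => hn l' (by simp [h']))).mono
        (by omega)).mono (R' := 2 * (n * n) + 1) (fun _ h => h) (by gcongr)
    have h2 := (ih (fun l' h' => hn l' (by simp [h'])) (fun l' h' => h l' (by simp [h']))
      fun l' h' => hQ l' (by simp [h'])).mul_left
      (P' := AxiomMultiple Q (n + 2 + rows.length * n)) (C (1 + t))
      fun x hx => by simpa using hx.mul (IsProd.of_C (1 + t))
    have h3 := h1.add h2
    have e : (List.map (genProd t) (l :: rows)).prod - (1 + C t) ^ (l :: rows).length =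
        (rows.map (genProd t)).prod * (genProd t l - (1 + C t)) +
          C (1 + t) * ((rows.map (genProd t)).prod - (1 + C t) ^ rows.length) := by
      simp only [List.map_cons, List.prod_cons, List.length_cons, C_add, C_1]
      ring
    rw [e]
    refine h3.mono (fun x hx => hx.mono ?_) ?_
    · simp only [List.length_cons]
      ring_nf
      omega
    · simp only [List.length_cons]
      ring_nf
      omega

/-- The combination with weights `w` of the products of `1 + t r * x` over the variables in the
given lists. -/
noncomputable def weightedProd {T : ℕ} (t w : Fin T → F) (cols : List (List σ)) :
    MvPolynomial σ F :=
  ∑ r, C (w r) * (cols.map (genProd (t r))).prod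

theorem sumOf_weightedProd {T : ℕ} (t w : Fin T → F) (cols : List (List σ)) {m : ℕ}
    (h : ∀ l ∈ cols, l.length ≤ m) :
    SumOf (IsProd (cols.length * m)) T (weightedProd t w cols) := by
  have := SumOf.finset_sum (P := IsProd (cols.length * m)) (R := 1) Finset.univ
    (fun r => C (w r) * (cols.map (genProd (t r))).prod) fun r _ => SumOf.single
      (by simpa using (IsProd.of_C (w r)).mul (isProd_prod_genProd (t r) cols h))
  simpa [weightedProd] using this

/-- The first column is replaced by `1 + t * ∑ x`, and the factor `t` is absorbed into the weights.
The last sum is the error, which the hole axioms control. -/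
theorem weightedProd_cons {T : ℕ} (t w : Fin T → F) (l : List σ) (cols : List (List σ)) :
    weightedProd t w (l :: cols) = weightedProd t w cols +
      (l.map fun v => X v * weightedProd t (fun r => t r * w r) cols).sum +
      ∑ r, C (w r) * (cols.map (genProd (t r))).prod *
        (genProd (t r) l - 1 - C (t r) * (l.map X).sum) := by
  rw [List.sum_map_mul_right, weightedProd, weightedProd, weightedProd, Finset.mul_sum,
    ← Finset.sum_add_distrib, ← Finset.sum_add_distrib]
  refine Finset.sum_congr rfl fun r _ => ?_
  simp only [List.map_cons, List.prod_cons, C_mul]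
  ring

end PigeonholeUpper

end OrderedPC
namespace OrderedPC

open MvPolynomial

/-! ### Explicit polynomial bounds. -/

section PigeonholeBounds

variable {R : Type*} [CommSemiring R]

/-- The number of affine factors of the polynomials that multiply axioms. -/
def phpDegree (n : R) : R := n + 3 + n * (n + 1)

/-- The formula size of the summands of the lines. -/
def phpTermSize (n : R) : R := (n + 2) * (6 * (n * (n + 1) + 1) + 1 + 1) + 12 * phpDegree n + 1

/-- The number of summands of a line which handles one hole. -/
def phpHoleTerms (n : R) : R := 1 + (n + 1) + (n + 2) * ((n + 1) * (n + 1))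

/-- The number of summands of the final line. -/
def phpPigeonTerms (n : R) : R := 1 + (n + 2) * ((n + 1) * (2 * (n * n) + 1))

/-- The formula size of the lines. -/
def phpLineSize (n : R) : R := (phpHoleTerms n + phpPigeonTerms n) * (phpTermSize n + 1) + 1

/-- The number of lines which handle one hole. -/
def phpHoleLines (n : R) : R := (n + 1) * (phpHoleTerms n * (2 * phpDegree n + 3))

/-- The size of the refutations of the pigeonhole principle with `n` holes. -/
def phpSize (n : R) : R :=
  (2 + n * phpHoleLines n + phpPigeonTerms n * (2 * phpDegree n + 3) + 1) * phpLineSize n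

end PigeonholeBounds

/-- The bounds are defined over every commutative semiring, so that one expression serves as
polynomial and as number. -/
theorem eval_phpSize (n : ℕ) : (phpSize (Polynomial.X : Polynomial ℕ)).eval n = phpSize n := by
  simp [phpSize, phpHoleLines, phpLineSize, phpPigeonTerms, phpHoleTerms, phpTermSize, phpDegree]

/-! ### The refutation of the functional pigeonhole principle. -/

section PigeonholeUpper

variable {F σ : Type*} [Field F] {Q : Set (MvPolynomial σ F)}

theorem le_phpLineSize (n : ℕ) : 12 * phpDegree n + 1 ≤ phpLineSize n := by
  have h1 : 12 * phpDegree n + 1 ≤ phpTermSize n := by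
    unfold phpTermSize
    omega
  have h2 : 1 ≤ phpHoleTerms n + phpPigeonTerms n := by
    unfold phpPigeonTerms
    omega
  unfold phpLineSize
  nlinarith

theorem AxiomMultiple.small_and_derives {n D : ℕ} {h : MvPolynomial σ F}
    (hh : AxiomMultiple Q D h) (hD : D ≤ phpDegree n) (ord : LinearOrder σ)
    (H : Set (MvPolynomial σ F)) :
    Small ord (phpTermSize n) h ∧
      Derives Q ord (phpLineSize n) H (2 * phpDegree n + 2) {h} :=
  ⟨((hh.mono hD).small ord).mono (by unfold phpTermSize; omega),
    (hh.mono hD).derives ord H (le_phpLineSize n)⟩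

theorem small_weightedProd {n : ℕ} (ord : LinearOrder σ) (t w : Fin (n + 2) → F)
    (cols : List (List σ)) (hn : cols.length ≤ n) (hm : ∀ l ∈ cols, l.length ≤ n + 1) :
    Small ord (phpTermSize n) (weightedProd t w cols) ∧
      ∀ v, Small ord (phpTermSize n) (X v * weightedProd t w cols) := by
  have h1 := sumOf_weightedProd t w cols hm
  have h3 : cols.length * (n + 1) ≤ n * (n + 1) := by gcongr
  have h4 : ∀ f : MvPolynomial σ F, SumOf (IsProd (n * (n + 1) + 1)) (n + 2) f →
      Small ord (phpTermSize n) f := fun f hf =>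
    (hf.mono (fun x hx => hx.small ord) le_rfl).small.mono (by unfold phpTermSize; omega)
  exact ⟨h4 _ (h1.mono (fun x hx => hx.mono (by omega)) le_rfl),
    fun v => h4 _ (h1.mul_left (X v) fun x hx => ((IsProd.of_X v).mul hx).mono (by omega))⟩

/-- Weights which annihilate the powers up to `n` annihilate the generating function of the
elementary symmetric polynomials over the variables of at most `n` holes. -/
theorem derives_weightedProd {n : ℕ} (ord : LinearOrder σ) (t w : Fin (n + 2) → F)
    (hw : ∀ j ≤ n, ∑ r, t r ^ j * w r = 0) (cols : List (List σ))
    (hm : ∀ l ∈ cols, l.length ≤ n + 1)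
    (hQ : ∀ l ∈ cols, l.Pairwise fun v w => X v * X w ∈ Q) (A : ℕ) (hA : cols.length + A ≤ n) :
    Derives Q ord (phpLineSize n) {0} (cols.length * phpHoleLines n)
      {f | ∃ a ≤ A, f = weightedProd t (fun r => t r ^ a * w r) cols} := by
  induction cols generalizing A with
  | nil =>
    refine Derives.of_subset ?_
    rintro f ⟨a, ha, rfl⟩
    -- Without columns only `∑ r, t r ^ a * w r` is left, which vanishes because `a ≤ A ≤ n`.
    simp only [weightedProd, List.map_nil, List.prod_nil, mul_one, ← map_sum]
    rw [hw a (by simp at hA; omega), map_zero]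
    rfl
  | cons l cols ih =>
    rw [List.length_cons] at hA
    -- Removing a column may raise the power of `t` in the weights by one, so the shorter list is
    -- needed for all exponents up to `A + 1`.
    have h1 := ih (fun l' h => hm l' (by simp [h])) (fun l' h => hQ l' (by simp [h])) (A + 1)
      (by omega)
    have hl := hm l (by simp)
    have hm' : ∀ l ∈ cols, l.length ≤ n + 1 := fun l' h => hm l' (by simp [h])
    set H : Set (MvPolynomial σ F) := {0} ∪
      {f | ∃ a ≤ A + 1, f = weightedProd t (fun r => t r ^ a * w r) cols} with hH
    have hmem : ∀ a ≤ A + 1, weightedProd t (fun r => t r ^ a * w r) cols ∈ H :=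
      fun a ha => Or.inr ⟨a, ha, rfl⟩
    have h2 : ∀ a ∈ List.range (A + 1), Derives Q ord (phpLineSize n) H
        (phpHoleTerms n * (2 * phpDegree n + 3))
        {weightedProd t (fun r => t r ^ a * w r) (l :: cols)} := by
      intro a ha
      rw [List.mem_range] at ha
      set P : MvPolynomial σ F → Prop := fun g => Small ord (phpTermSize n) g ∧
        Derives Q ord (phpLineSize n) H (2 * phpDegree n + 2) {g}
      have e1 : SumOf P 1 (weightedProd t (fun r => t r ^ a * w r) cols) :=
        SumOf.single ⟨(small_weightedProd ord t _ cols (by omega) hm').1,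
          Derives.of_subset (by simpa using hmem a (by omega))⟩
      have e2 := SumOf.list_sum (P := P)
        (l.map fun v => X v * weightedProd t (fun r => t r * (t r ^ a * w r)) cols) (by
          intro f hf
          obtain ⟨v, -, rfl⟩ := List.mem_map.1 hf
          have hv := (small_weightedProd ord t (fun r => t r * (t r ^ a * w r)) cols
            (by omega) hm').2 v
          refine ⟨hv, (Derives.X_mul v ?_ (hv.mono ?_)).mono subset_rfl (by omega) subset_rfl⟩
          · have := hmem (a + 1) (by omega)
            simpa only [pow_succ', mul_assoc] using this
          · have : 1 ≤ phpHoleTerms n + phpPigeonTerms n := by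
              unfold phpPigeonTerms
              omega
            unfold phpLineSize
            nlinarith)
      have e3 := SumOf.finset_sum (P := P) (R := (n + 1) * (n + 1)) Finset.univ
        (fun r => C (t r ^ a * w r) * (cols.map (genProd (t r))).prod *
          (genProd (t r) l - 1 - C (t r) * (l.map X).sum)) (by
          intro r _
          refine ((sumOf_genProd_sub (t r) l (hQ l (by simp))).mul_left (P' := P) _ ?_).mono
            (fun _ h => h) (by gcongr)
          intro x hx
          refine (hx.mul ((IsProd.of_C (t r ^ a * w r)).mul
            (isProd_prod_genProd (t r) cols hm'))).small_and_derives ?_ ord H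
          have h3 : cols.length * (n + 1) ≤ n * (n + 1) := by gcongr; omega
          unfold phpDegree
          omega)
      rw [weightedProd_cons]
      refine (((e1.add e2).add e3).mono (fun _ h => h)
        (show _ ≤ phpHoleTerms n by simp [phpHoleTerms]; omega)).derives (by simp [hH]) ?_
      unfold phpLineSize
      gcongr
      omega
    have h3 := Derives.list _ _ h2
    refine (h1.trans' h3).mono subset_rfl ?_ ?_
    · rw [List.length_cons, Nat.succ_mul cols.length, List.length_range]
      have : (A + 1) * (phpHoleTerms n * (2 * phpDegree n + 3)) ≤ phpHoleLines n := by
        unfold phpHoleLines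
        gcongr
        omega
      omega
    · rintro f ⟨a, ha, rfl⟩
      exact ⟨a, by simp; omega, rfl⟩

/-- Lagrange weights. -/
theorem exists_weights {n : ℕ} (t : Fin (n + 2) ↪ F) :
    ∃ w : Fin (n + 2) → F, (∀ j ≤ n, ∑ r, t r ^ j * w r = 0) ∧
      ∑ r, w r * (1 + t r) ^ (n + 1) = 1 := by
  have hdet : IsUnit (Matrix.vandermonde fun r => 1 + t r).det := by
    rw [isUnit_iff_ne_zero, Matrix.det_vandermonde_ne_zero_iff]
    intro a b h
    exact t.injective (add_left_cancel h)
  -- The row vector `w` satisfies `w V = e` for the last unit vector `e`: it annihilates the powers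
  -- of `1 + t r` up to `n` and sends the power `n + 1` to `1`.
  set V := Matrix.vandermonde fun r => 1 + t r with hV
  set w := Matrix.vecMul (Pi.single (Fin.last (n + 1)) 1) V⁻¹ with hw
  have h1 : Matrix.vecMul w V = Pi.single (Fin.last (n + 1)) 1 := by
    rw [hw, Matrix.vecMul_vecMul, Matrix.nonsing_inv_mul _ hdet, Matrix.vecMul_one]
  have h2 : ∀ j : Fin (n + 2), ∑ r, w r * (1 + t r) ^ (j : ℕ) =
      (Pi.single (Fin.last (n + 1)) 1 : Fin (n + 2) → F) j := by
    intro j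
    rw [← h1]
    simp [Matrix.vecMul, dotProduct, hV, Matrix.vandermonde_apply]
  have h3 : ∀ j ≤ n, ∑ r, w r * (1 + t r) ^ j = 0 := by
    intro j hj
    have := h2 ⟨j, by omega⟩
    rw [Pi.single_eq_of_ne] at this
    · exact this
    · intro h
      have := congrArg Fin.val h
      simp at this
      omega
  refine ⟨w, fun j hj => ?_, by simpa using h2 (Fin.last (n + 1))⟩
  -- The binomial expansion of `((1 + t r) - 1) ^ j` passes from powers of `1 + t r` to powers of `t
  -- r`.
  have h4 : ∀ r, t r ^ j * w r =
      ∑ i ∈ Finset.range (j + 1), w r * (1 + t r) ^ i * ((-1) ^ (j - i) * (j.choose i)) := by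
    intro r
    have : t r ^ j = ((1 + t r) + (-1)) ^ j := by ring
    rw [this, add_pow, Finset.sum_mul]
    exact Finset.sum_congr rfl fun i _ => by ring
  simp only [h4]
  rw [Finset.sum_comm]
  refine Finset.sum_eq_zero fun i hi => ?_
  rw [← Finset.sum_mul, h3 i (by simp at hi; omega), zero_mul]

/-- Polynomial size refutations of the functional pigeonhole principle with `n + 1` pigeons and
`n` holes. The variables of a pigeon form a row, those of a hole form a column. -/
theorem exists_refutation_of_rows_cols {n : ℕ} (ord : LinearOrder σ) (t : Fin (n + 2) ↪ F)
    (rows cols : List (List σ)) (hrows : rows.length = n + 1) (hcols : cols.length = n)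
    (hrow : ∀ l ∈ rows, l.length = n) (hcol : ∀ l ∈ cols, l.length = n + 1)
    (hprod : ∀ a : F, (rows.map (genProd a)).prod = (cols.map (genProd a)).prod)
    (hrowQ : ∀ l ∈ rows, l.Pairwise fun v w => X v * X w ∈ Q)
    (hcolQ : ∀ l ∈ cols, l.Pairwise fun v w => X v * X w ∈ Q)
    (hQ : ∀ l ∈ rows, ∃ c : F, c ≠ 0 ∧ C c * genProd (-1) l ∈ Q) :
    ∃ φs : List (NCFormula F σ), IsOFPCRefutation ord Q φs ∧ ofpcSize φs ≤ phpSize n := by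
  obtain ⟨w, hw, hw1⟩ := exists_weights t
  have hB := le_phpLineSize n
  -- The line `0` starts the derivations of sums. It is a trivial combination of a pigeon axiom,
  -- which exists since there are `n + 1` rows.
  have hzero : Derives Q ord (phpLineSize n) ∅ 2 {0} := by
    obtain ⟨l, hl⟩ := List.exists_mem_of_length_pos (l := rows) (by omega)
    obtain ⟨c, -, hcQ⟩ := hQ l hl
    have h1 : Derives Q ord (phpLineSize n) ∅ 1 {C c * genProd (-1) l} := by
      refine Derives.hyp hcQ ((((IsProd.of_C c).mul (isProd_genProd (-1) l)).small ord).mono ?_)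
      rw [hrow l hl]
      unfold phpDegree at hB
      omega
    exact h1.trans' (Derives.linear 0 0 (by simp : C c * genProd (-1) l ∈ _)
      (by simp : C c * genProd (-1) l ∈ _) (by simp) (Small.zero ord (by omega)))
  have hE := (derives_weightedProd ord t w hw cols (fun l h => (hcol l h).le) hcolQ 0
    (by omega)).mono (H' := ∅ ∪ {0}) (G' := {weightedProd t w cols}) (by simp) le_rfl
    (by rintro f rfl; exact ⟨0, le_rfl, by simp⟩)
  set H : Set (MvPolynomial σ F) := ∅ ∪ ({0} ∪ {weightedProd t w cols}) with hH
  set P : MvPolynomial σ F → Prop := fun g => Small ord (phpTermSize n) g ∧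
    Derives Q ord (phpLineSize n) H (2 * phpDegree n + 2) {g}
  have h3 : n * (n + 1) = (n + 1) * n := mul_comm _ _
  have e1 : SumOf P 1 (weightedProd t w cols) :=
    SumOf.single ⟨(small_weightedProd ord t w cols hcols.le fun l h => (hcol l h).le).1,
      Derives.of_subset (by simp [hH])⟩
  have e2 := SumOf.finset_sum (P := P) (R := (n + 1) * (2 * (n * n) + 1)) Finset.univ
    (fun r => C (-w r) * ((rows.map (genProd (t r))).prod - (1 + C (t r)) ^ (n + 1))) (by
      intro r _
      have := sumOf_prod_genProd_sub (t r) rows (fun l h => (hrow l h).le) hrowQ hQ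
      rw [hrows] at this
      refine this.mul_left _ fun x hx => ?_
      refine (hx.mul (IsProd.of_C (-w r))).small_and_derives ?_ ord H
      unfold phpDegree
      omega)
  -- By `hprod` the row and column products cancel, and `∑ r, w r * (1 + t r) ^ (n + 1) = 1`
  -- remains.
  have hone : (1 : MvPolynomial σ F) = weightedProd t w cols +
      ∑ r, C (-w r) * ((rows.map (genProd (t r))).prod - (1 + C (t r)) ^ (n + 1)) := by
    simp only [weightedProd, hprod]
    rw [← Finset.sum_add_distrib]
    calc (1 : MvPolynomial σ F) = C (∑ r, w r * (1 + t r) ^ (n + 1)) := by rw [hw1, C_1]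
      _ = _ := by
        rw [map_sum]
        refine Finset.sum_congr rfl fun r _ => ?_
        simp only [C_mul, C_pow, C_add, C_1, C_neg]
        ring
  have h1 : Derives Q ord (phpLineSize n) H (phpPigeonTerms n * (2 * phpDegree n + 3)) {1} := by
    rw [hone]
    refine ((e1.add e2).mono (fun _ h => h)
      (show _ ≤ phpPigeonTerms n by simp [phpPigeonTerms])).derives (by simp [hH]) ?_
    unfold phpLineSize
    gcongr
    omega
  rw [hcols] at hE
  exact ((hzero.trans hE).trans' h1).exists_refutation (by omega)

end PigeonholeUpper

end OrderedPC
namespace OrderedPC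

open MvPolynomial

/-! ### Simulation of resolution. -/

section ResolutionSimulation

variable {F σ : Type*} [Field F]

theorem isProd_clausePoly (C : Clause σ) : IsProd C.card (clausePoly F C) := by
  classical
  unfold clausePoly
  induction C using Finset.induction_on with
  | empty => simpa using IsProd.one
  | insert l C hl ih =>
    rw [Finset.prod_insert hl, Finset.card_insert_of_notMem hl, add_comm]
    refine IsProd.mul ?_ ih
    have := IsProd.affine (-(if l.2 then 1 else 0) : F) 1 l.1
    rw [C_1, one_mul, C_neg] at this
    rwa [sub_eq_neg_add]

/-- This is weakening: the premise is multiplied by the missing literals of the resolvent. The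
identity also holds if `l ∈ C`. -/
theorem clausePoly_erase_mul [DecidableEq σ] {A C : Clause σ} {l : Literal σ} (hl : l ∈ A)
    (hC : A.erase l ⊆ C) :
    clausePoly F A * clausePoly F (C \ A.erase l) =
      (X l.1 - MvPolynomial.C (if l.2 then 1 else 0)) * clausePoly F C := by
  unfold clausePoly
  rw [← Finset.mul_prod_erase A _ hl, mul_assoc, mul_comm (∏ x ∈ A.erase l, _),
    Finset.prod_sdiff hC]

/-- The resolution rule is simulated by multiplying and subtracting clause polynomials. -/
theorem derives_resolvent [DecidableEq σ] {Q H : Set (MvPolynomial σ F)} (ord : LinearOrder σ)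
    {d : ℕ} {A B : Clause σ} {x : σ} (hA : (x, true) ∈ A) (hB : (x, false) ∈ B)
    (hAd : A.card ≤ d) (hBd : B.card ≤ d)
    (hd : (A.erase (x, true) ∪ B.erase (x, false)).card ≤ d)
    (hAH : clausePoly F A ∈ H) (hBH : clausePoly F B ∈ H) :
    Derives Q ord (12 * d + 1) H (4 * d + 3)
      {clausePoly F (A.erase (x, true) ∪ B.erase (x, false))} := by
  set C := A.erase (x, true) ∪ B.erase (x, false) with hC
  have h1 : Derives Q ord (12 * d + 1) H (2 * d + 1) {(X x - 1) * clausePoly F C} := by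
    have := Derives.mul_isProd (Q := Q) (ord := ord) (B := 12 * d + 1)
      ((isProd_clausePoly A).mono hAd) ((isProd_clausePoly (C \ A.erase (x, true))).mono
        ((Finset.card_le_card Finset.sdiff_subset).trans hd)) hAH (by omega)
    rw [clausePoly_erase_mul hA Finset.subset_union_left] at this
    simpa using this
  have h2 : Derives Q ord (12 * d + 1) (H ∪ {(X x - 1) * clausePoly F C}) (2 * d + 1)
      {X x * clausePoly F C} := by
    have := Derives.mul_isProd (Q := Q) (ord := ord) (B := 12 * d + 1)
      (H := H ∪ {(X x - 1) * clausePoly F C}) ((isProd_clausePoly B).mono hBd)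
      ((isProd_clausePoly (C \ B.erase (x, false))).mono
        ((Finset.card_le_card Finset.sdiff_subset).trans hd))
      (Or.inl hBH) (by omega)
    rw [clausePoly_erase_mul hB Finset.subset_union_right] at this
    simpa using this
  have h3 : Derives Q ord (12 * d + 1)
      (H ∪ ({(X x - 1) * clausePoly F C} ∪ {X x * clausePoly F C})) 1 {clausePoly F C} := by
    refine Derives.linear 1 (-1) (p := X x * clausePoly F C) (q := (X x - 1) * clausePoly F C)
      (by simp) (by simp) ?_ (((isProd_clausePoly C).small ord).mono (by omega))
    simp only [C_1, C_neg]
    ring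
  exact ((h1.trans h2).trans' h3).mono subset_rfl (by omega) subset_rfl

/-- The number of variables resolved upon is at most the length of the refutation. -/
theorem exists_pivots [DecidableEq σ] [Nonempty σ] {K : CNF σ} {π : List (Clause σ)}
    (h : ∀ (i : ℕ) (h : i < π.length), ResStep K (π.take i) π[i]) :
    ∃ V : Finset σ, V.card ≤ π.length ∧ ∀ (i : ℕ) (h : i < π.length), π[i] ∈ K ∨
      ∃ x ∈ V, ∃ A ∈ π.take i, ∃ B ∈ π.take i, (x, true) ∈ A ∧ (x, false) ∈ B ∧
        π[i] = A.erase (x, true) ∪ B.erase (x, false) := by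
  have h1 : ∀ i : Fin π.length, ∃ x : σ, π[i] ∈ K ∨ ∃ A ∈ π.take i, ∃ B ∈ π.take i,
      (x, true) ∈ A ∧ (x, false) ∈ B ∧ π[i] = A.erase (x, true) ∪ B.erase (x, false) := by
    intro i
    rcases h i i.2 with h | ⟨x, h⟩
    -- Axioms have no pivot; any value will do, as only the number of pivots matters.
    · exact ⟨Classical.arbitrary σ, Or.inl h⟩
    · exact ⟨x, Or.inr h⟩
  choose x hx using h1
  refine ⟨Finset.univ.image x, Finset.card_image_le.trans (by simp), fun i hi => ?_⟩
  exact (hx ⟨i, hi⟩).imp_right fun h => ⟨x ⟨i, hi⟩, by simp, h⟩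

/-- Clauses of `K` may be far wider than `s`, so only clauses over the pivot variables `V` are
derived; they have at most `2 * s` literals. This suffices: if a resolvent is over `V`, so are its
premises, whose only other variable is the pivot. -/
theorem derives_clausePoly [DecidableEq σ] (ord : LinearOrder σ) {K : CNF σ}
    {π : List (Clause σ)} {V : Finset σ} {s : ℕ} (hV : V.card ≤ s)
    (h : ∀ (i : ℕ) (h : i < π.length), π[i] ∈ K ∨
      ∃ x ∈ V, ∃ A ∈ π.take i, ∃ B ∈ π.take i, (x, true) ∈ A ∧ (x, false) ∈ B ∧
        π[i] = A.erase (x, true) ∪ B.erase (x, false)) (i : ℕ) (hi : i ≤ π.length) :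
    Derives (cnfPolys F K) ord (12 * (2 * s) + 1) ∅ (i * (4 * (2 * s) + 3))
      {f | ∃ C ∈ π.take i, (∀ l ∈ C, l.1 ∈ V) ∧ f = clausePoly F C} := by
  have hcard : ∀ C : Clause σ, (∀ l ∈ C, l.1 ∈ V) → C.card ≤ 2 * s := by
    intro C hC
    have : C ⊆ V ×ˢ Finset.univ := fun l hl => by simpa using hC l hl
    have := Finset.card_le_card this
    rw [Finset.card_product, Finset.card_univ, Fintype.card_bool] at this
    omega
  induction i with
  | zero => exact Derives.of_subset (by simp)
  | succ i ih =>
    have ih := ih (by omega)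
    have hi' : i < π.length := hi
    have hstep : (∀ l ∈ π[i], l.1 ∈ V) → Derives (cnfPolys F K) ord (12 * (2 * s) + 1)
        (∅ ∪ {f | ∃ C ∈ π.take i, (∀ l ∈ C, l.1 ∈ V) ∧ f = clausePoly F C})
        (4 * (2 * s) + 3) {clausePoly F π[i]} := by
      intro hC
      rcases h i hi' with hK | ⟨x, hx, A, hA, B, hB, hxA, hxB, he⟩
      · exact (Derives.hyp (show _ ∈ cnfPolys F K from ⟨_, hK, rfl⟩)
          (((isProd_clausePoly _).small ord).mono
          (by have := hcard _ hC; omega))).mono subset_rfl (by omega) subset_rfl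
      · rw [he] at hC ⊢
        have hAV : ∀ l ∈ A, l.1 ∈ V := by
          intro l hl
          by_cases hlx : l = (x, true)
          · rwa [hlx]
          · exact hC l (Finset.mem_union_left _ (Finset.mem_erase.2 ⟨hlx, hl⟩))
        have hBV : ∀ l ∈ B, l.1 ∈ V := by
          intro l hl
          by_cases hlx : l = (x, false)
          · rwa [hlx]
          · exact hC l (Finset.mem_union_right _ (Finset.mem_erase.2 ⟨hlx, hl⟩))
        exact derives_resolvent ord hxA hxB (hcard A hAV) (hcard B hBV) (hcard _ hC)
          (Or.inr ⟨A, hA, hAV, rfl⟩) (Or.inr ⟨B, hB, hBV, rfl⟩)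
    by_cases hC : ∀ l ∈ π[i], l.1 ∈ V
    · refine (ih.trans (hstep hC)).mono subset_rfl (by rw [Nat.succ_mul i]) ?_
      rintro f ⟨C, hCm, hCV, rfl⟩
      rw [List.take_succ_eq_append_getElem hi', List.mem_append, List.mem_singleton] at hCm
      rcases hCm with hCm | rfl
      · exact Or.inl ⟨C, hCm, hCV, rfl⟩
      · exact Or.inr rfl
    · refine ih.mono subset_rfl (by gcongr; omega) ?_
      rintro f ⟨C, hCm, hCV, rfl⟩
      rw [List.take_succ_eq_append_getElem hi', List.mem_append, List.mem_singleton] at hCm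
      rcases hCm with hCm | rfl
      · exact ⟨C, hCm, hCV, rfl⟩
      · exact absurd hCV hC

theorem polySimulates_ofpc_resolution (F : Type*) [Field F] (ord : LinearOrder ℕ) :
    PolySimulates (ofpc F ord) resolution := by
  refine ⟨(Polynomial.X * (4 * (2 * Polynomial.X) + 3) + 1) * (12 * (2 * Polynomial.X) + 1), ?_⟩
  rintro K s ⟨π, ⟨h1, h2⟩, rfl⟩
  obtain ⟨V, hV, h3⟩ := exists_pivots h1
  have h4 := derives_clausePoly (F := F) ord hV h3 π.length le_rfl
  have h5 : Derives (cnfPolys F K) ord (12 * (2 * π.length) + 1) ∅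
      (π.length * (4 * (2 * π.length) + 3)) {1} := by
    refine h4.mono subset_rfl le_rfl ?_
    rintro f rfl
    exact ⟨∅, by simpa using List.mem_of_getLast? h2, by simp, by simp [clausePoly]⟩
  obtain ⟨φs, h6, h7⟩ := h5.exists_refutation (by omega)
  exact ⟨ofpcSize φs, by simpa using h7, φs, h6, rfl⟩

end ResolutionSimulation

end OrderedPC
namespace OrderedPC

/-! ### The lower bound for resolution. -/

section PigeonholeLower

variable {σ : Type*} {n : ℕ}

theorem update_injective {f : Fin n → Fin (n + 1)} (hf : f.Injective) {i : Fin (n + 1)}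
    (hi : ∀ k, f k ≠ i) (k : Fin n) : (Function.update f k i).Injective := by
  intro a b hab
  by_cases ha : a = k <;> by_cases hb : b = k
  · rw [ha, hb]
  · subst ha
    rw [Function.update_self, Function.update_of_ne hb] at hab
    exact absurd hab.symm (hi b)
  · subst hb
    rw [Function.update_self, Function.update_of_ne ha] at hab
    exact absurd hab (hi a)
  · rw [Function.update_of_ne ha, Function.update_of_ne hb] at hab
    exact hf hab

theorem eq_of_forall_ne {f : Fin n → Fin (n + 1)} (hf : f.Injective) {i j : Fin (n + 1)}
    (hi : ∀ k, f k ≠ i) (hj : ∀ k, f k ≠ j) : i = j := by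
  by_contra hij
  have h1 : (Finset.univ.image f).card = n := by
    rw [Finset.card_image_of_injective _ hf, Finset.card_univ, Fintype.card_fin]
  have h2 : Disjoint (Finset.univ.image f) {i, j} := by
    rw [Finset.disjoint_right]
    intro a ha hb
    obtain ⟨k, -, rfl⟩ := Finset.mem_image.1 hb
    rcases Finset.mem_insert.1 ha with h | h
    · exact hi k h
    · exact hj k (Finset.mem_singleton.1 h)
  have h3 := Finset.card_le_univ (Finset.univ.image f ∪ {i, j})
  rw [Finset.card_union_of_disjoint h2, h1, Finset.card_pair hij, Fintype.card_fin] at h3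
  omega

/-- The clause `C` is false under the assignment that puts the pigeon `f k` into the hole `k`;
`e i k` is the variable which says that pigeon `i` sits in hole `k`. -/
def Falsifies (e : Fin (n + 1) → Fin n → σ) (f : Fin n → Fin (n + 1)) (C : Clause σ) : Prop :=
  ∀ l ∈ C, ¬ ((∃ k, e (f k) k = l.1) ↔ l.2 = true)

open Classical in
/-- The pigeons that are left out by an assignment which extends `g` on `H` and falsifies `C`. -/
noncomputable def critical (e : Fin (n + 1) → Fin n → σ) (g : Fin n → Fin (n + 1))
    (H : Finset (Fin n)) (C : Clause σ) : Finset (Fin (n + 1)) :=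
  {i | ∃ f : Fin n → Fin (n + 1), f.Injective ∧ (∀ k ∈ H, f k = g k) ∧ (∀ k, f k ≠ i) ∧
    Falsifies e f C}

open Classical in
/-- The pairs of a pigeon and a hole which make `C` true in every one-to-one assignment. -/
noncomputable def cells (e : Fin (n + 1) → Fin n → σ) (C : Clause σ) :
    Finset (Fin (n + 1) × Fin n) :=
  {c | (e c.1 c.2, true) ∈ C ∨ ∃ j, j ≠ c.1 ∧ (e j c.2, false) ∈ C}

/-- The pairs of a pigeon and a hole which are unmatched by `g` on `H`. -/
def freeCells (g : Fin n → Fin (n + 1)) (H : Finset (Fin n)) : Finset (Fin (n + 1) × Fin n) :=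
  {c | c.2 ∉ H ∧ ∀ k ∈ H, g k ≠ c.1}

theorem mem_critical {e : Fin (n + 1) → Fin n → σ} {g : Fin n → Fin (n + 1)}
    {H : Finset (Fin n)} {C : Clause σ} {i : Fin (n + 1)} :
    i ∈ critical e g H C ↔ ∃ f : Fin n → Fin (n + 1), f.Injective ∧ (∀ k ∈ H, f k = g k) ∧
      (∀ k, f k ≠ i) ∧ Falsifies e f C := by
  simp [critical]

theorem mem_cells {e : Fin (n + 1) → Fin n → σ} {C : Clause σ} {i : Fin (n + 1)} {k : Fin n} :
    (i, k) ∈ cells e C ↔ (e i k, true) ∈ C ∨ ∃ j, j ≠ i ∧ (e j k, false) ∈ C := by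
  simp [cells]

theorem mem_freeCells {g : Fin n → Fin (n + 1)} {H : Finset (Fin n)} {i : Fin (n + 1)}
    {k : Fin n} : (i, k) ∈ freeCells g H ↔ k ∉ H ∧ ∀ k ∈ H, g k ≠ i := by
  simp [freeCells]

/-- An assignment that falsifies the resolvent falsifies the premise whose pivot literal it makes
false. -/
theorem critical_resolvent_subset [DecidableEq σ] (e : Fin (n + 1) → Fin n → σ)
    (g : Fin n → Fin (n + 1)) (H : Finset (Fin n)) (A B : Clause σ) (x : σ) :
    critical e g H (A.erase (x, true) ∪ B.erase (x, false)) ⊆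
      critical e g H A ∪ critical e g H B := by
  intro i hi
  obtain ⟨f, h1, h2, h3, h4⟩ := mem_critical.1 hi
  rw [Finset.mem_union, mem_critical, mem_critical]
  by_cases hx : ∃ k, e (f k) k = x
  · refine Or.inr ⟨f, h1, h2, h3, fun l hl => ?_⟩
    by_cases hlx : l = (x, false)
    · subst hlx
      simpa using hx
    · exact h4 l (Finset.mem_union_right _ (Finset.mem_erase.2 ⟨hlx, hl⟩))
  · refine Or.inl ⟨f, h1, h2, h3, fun l hl => ?_⟩
    by_cases hlx : l = (x, true)
    · subst hlx
      simpa using hx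
    · exact h4 l (Finset.mem_union_left _ (Finset.mem_erase.2 ⟨hlx, hl⟩))

/-- All assignments in question leave out `i`, and an injection of `n` holes into `n + 1` pigeons
leaves out only one pigeon. This is the case of the initial clauses. -/
theorem card_critical_le_one (e : Fin (n + 1) → Fin n → σ) (g : Fin n → Fin (n + 1))
    (H : Finset (Fin n)) (C : Clause σ) {i : Fin (n + 1)}
    (h : ∀ f : Fin n → Fin (n + 1), f.Injective → Falsifies e f C → ∀ k, f k ≠ i) :
    (critical e g H C).card ≤ 1 := by
  refine (Finset.card_le_card (t := {i}) fun j hj => ?_).trans (by simp)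
  obtain ⟨f, h1, -, h3, h4⟩ := mem_critical.1 hj
  exact Finset.mem_singleton.2 (eq_of_forall_ne h1 h3 (h f h1 h4))

theorem critical_empty (e : Fin (n + 1) → Fin n → σ) {g : Fin n → Fin (n + 1)}
    (hg : g.Injective) (H : Finset (Fin n)) : critical e g H ∅ = (H.image g)ᶜ := by
  ext i
  rw [mem_critical, Finset.mem_compl, Finset.mem_image, not_exists]
  constructor
  · rintro ⟨f, -, h2, h3, -⟩ k ⟨hk, rfl⟩
    exact h3 k (h2 k hk)
  · intro hi
    by_cases h : ∃ k, g k = i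
    · obtain ⟨k, rfl⟩ := h
      have hk : k ∉ H := fun hk => hi k ⟨hk, rfl⟩
      obtain ⟨j, hj⟩ : ∃ j, ∀ k, g k ≠ j := by
        by_contra! hs
        have := Fintype.card_le_of_surjective g hs
        simp at this
      -- The pigeon `g k` is freed by putting the pigeon `j`, which `g` leaves out, into the hole `k
      -- ∉ H`.
      refine ⟨Function.update g k j, update_injective hg hj k, ?_, ?_, fun l hl => by simp at hl⟩
      · intro a ha
        rw [Function.update_of_ne]
        rintro rfl
        exact hk ha
      · intro a
        by_cases ha : a = k
        · rw [ha, Function.update_self]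
          exact (hj k).symm
        · rw [Function.update_of_ne ha]
          exact fun h => ha (hg h)
    · push Not at h
      exact ⟨g, hg, fun _ _ => rfl, h, fun l hl => by simp at hl⟩

theorem card_image_compl {g : Fin n → Fin (n + 1)} (hg : g.Injective) (H : Finset (Fin n)) :
    ((H.image g)ᶜ).card = n + 1 - H.card := by
  rw [Finset.card_compl, Finset.card_image_of_injective _ hg, Fintype.card_fin]

theorem critical_subset (e : Fin (n + 1) → Fin n → σ) {g : Fin n → Fin (n + 1)}
    (H : Finset (Fin n)) (C : Clause σ) : critical e g H C ⊆ (H.image g)ᶜ := by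
  intro i hi
  obtain ⟨f, -, h2, h3, -⟩ := mem_critical.1 hi
  rw [Finset.mem_compl, Finset.mem_image]
  rintro ⟨k, hk, rfl⟩
  exact h3 k (h2 k hk)

/-- A matching which meets the cells of a clause satisfies the clause. -/
theorem critical_eq_empty {e : Fin (n + 1) → Fin n → σ}
    (he : ∀ i j k l, e i k = e j l → i = j ∧ k = l) {g : Fin n → Fin (n + 1)}
    {H : Finset (Fin n)} {C : Clause σ} {k : Fin n} (hk : k ∈ H) (h : (g k, k) ∈ cells e C) :
    critical e g H C = ∅ := by
  rw [Finset.eq_empty_iff_forall_notMem]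
  intro i hi
  obtain ⟨f, -, h2, -, h4⟩ := mem_critical.1 hi
  rcases mem_cells.1 h with h | ⟨j, hj, h⟩
  · exact h4 _ h (by simpa using ⟨k, by rw [h2 k hk]⟩)
  · refine h4 _ h (by
      simp only [Bool.false_eq_true, iff_false, not_exists]
      intro k' hk'
      obtain ⟨h5, rfl⟩ := he _ _ _ _ hk'
      rw [h2 k' hk] at h5
      exact hj h5.symm)

/-- Moving the critical pigeon into an occupied hole changes the truth value of a literal. -/
theorem mem_cells_of_swap {e : Fin (n + 1) → Fin n → σ} {f : Fin n → Fin (n + 1)} {C : Clause σ}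
    {i : Fin (n + 1)} {k : Fin n} (hi : ∀ k, f k ≠ i) (h : Falsifies e f C)
    (h' : ¬ Falsifies e (Function.update f k i) C) : (i, k) ∈ cells e C := by
  unfold Falsifies at h'
  push Not at h'
  obtain ⟨⟨v, b⟩, hl, h1⟩ := h'
  have h2 := h _ hl
  rw [mem_cells]
  cases b
  · simp only [Bool.false_eq_true, iff_false, not_exists, not_not, not_forall] at h1 h2
    obtain ⟨k', rfl⟩ := h2
    by_cases hk : k' = k
    · subst hk
      exact Or.inr ⟨f k', hi k', hl⟩
    · exact absurd (by rw [Function.update_of_ne hk]) (h1 k')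
  · simp only [iff_true, not_exists] at h1 h2
    obtain ⟨k', rfl⟩ := h1
    by_cases hk : k' = k
    · subst hk
      rw [Function.update_self] at hl
      exact Or.inl hl
    · exact absurd (by rw [Function.update_of_ne hk]) (h2 k')

/-- A clause with an intermediate number of critical pigeons is wide. -/
theorem card_critical_mul_le {e : Fin (n + 1) → Fin n → σ} {g : Fin n → Fin (n + 1)}
    (hg : g.Injective) (H : Finset (Fin n)) (C : Clause σ) :
    (critical e g H C).card * (n + 1 - H.card - (critical e g H C).card) ≤
      (cells e C ∩ freeCells g H).card := by
  have h1 : ∀ i, ∃ f : Fin n → Fin (n + 1), i ∈ critical e g H C → f.Injective ∧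
      (∀ k ∈ H, f k = g k) ∧ (∀ k, f k ≠ i) ∧ Falsifies e f C := by
    intro i
    by_cases hi : i ∈ critical e g H C
    · obtain ⟨f, hf⟩ := mem_critical.1 hi
      exact ⟨f, fun _ => hf⟩
    · exact ⟨g, fun h => absurd h hi⟩
  choose f hf using h1
  -- If `i` is critical and `j` is not, then `j` sits in some hole `k` of the assignment `f i`.
  -- Moving `i` into `k` leaves out `j`, so `C` becomes true and `(i, k)` is a free cell. The pair
  -- `(i, j)` is recovered from `(i, k)` as `(i, f i k)`.
  have h2 : critical e g H C ×ˢ ((H.image g)ᶜ \ critical e g H C) ⊆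
      (cells e C ∩ freeCells g H).image fun c => (c.1, f c.1 c.2) := by
    rintro ⟨i, j⟩ hij
    simp only [Finset.mem_product, Finset.mem_sdiff, Finset.mem_compl, Finset.mem_image,
      not_exists, not_and] at hij
    obtain ⟨hi, hjH, hj⟩ := hij
    obtain ⟨h3, h4, h5, h6⟩ := hf i hi
    have hiH := critical_subset e H C hi
    simp only [Finset.mem_compl, Finset.mem_image, not_exists, not_and] at hiH
    obtain ⟨k, rfl⟩ : ∃ k, f i k = j := by
      by_contra! hne
      exact hj (eq_of_forall_ne h3 h5 hne ▸ hi)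
    have hk : k ∉ H := fun hk => hjH k hk (h4 k hk).symm
    refine Finset.mem_image.2 ⟨(i, k), Finset.mem_inter.2 ⟨?_, mem_freeCells.2 ⟨hk, hiH⟩⟩, rfl⟩
    refine mem_cells_of_swap h5 h6 fun h7 => hj (mem_critical.2
      ⟨Function.update (f i) k i, update_injective h3 h5 k, ?_, ?_, h7⟩)
    · intro a ha
      rw [Function.update_of_ne, h4 a ha]
      rintro rfl
      exact hk ha
    · intro a
      by_cases ha : a = k
      · rw [ha, Function.update_self]
        exact (h5 k).symm
      · rw [Function.update_of_ne ha]
        exact fun h => ha (h3 h)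
  have h3 := (Finset.card_le_card h2).trans Finset.card_image_le
  rwa [Finset.card_product, Finset.card_sdiff_of_subset (critical_subset e H C),
    card_image_compl hg] at h3

/-- The number of critical pigeons is at most one at axioms, subadditive under resolution and `n + 1
- H.card` at the empty clause. The first clause that reaches `c` comes from two clauses with at most
`c - 1`, so its value is at most `2 * c - 2`. -/
theorem exists_intermediate_clause [DecidableEq σ] {e : Fin (n + 1) → Fin n → σ}
    {g : Fin n → Fin (n + 1)} (hg : g.Injective) (H : Finset (Fin n)) {K : CNF σ}
    (hK : ∀ C ∈ K, ∃ i, ∀ f : Fin n → Fin (n + 1), f.Injective → Falsifies e f C →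
      ∀ k, f k ≠ i) {π : List (Clause σ)} (hπ : IsResRefutation K π) {c : ℕ} (hc : 2 ≤ c)
    (hcH : c ≤ n + 1 - H.card) :
    ∃ C ∈ π, c ≤ (critical e g H C).card ∧ (critical e g H C).card + 2 ≤ 2 * c := by
  by_contra! hno
  have h1 : ∀ (i : ℕ) (hi : i < π.length), (critical e g H π[i]).card < c := by
    intro i
    induction i using Nat.strong_induction_on with
    | _ i ih =>
      intro hi
      by_contra! hle
      have h2 := hno _ (List.getElem_mem hi) hle
      rcases hπ.1 i hi with h | ⟨x, A, hA, B, hB, -, -, h⟩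
      · obtain ⟨j, hj⟩ := hK _ h
        have := card_critical_le_one e g H _ hj
        omega
      · have h3 : ∀ A ∈ π.take i, (critical e g H A).card < c := by
          intro A hA
          obtain ⟨j, hj, rfl⟩ := List.mem_take_iff_getElem.1 hA
          exact ih j (by omega) (by omega)
        have h4 := (Finset.card_le_card (critical_resolvent_subset e g H A B x)).trans
          (Finset.card_union_le _ _)
        rw [← h] at h4
        have := h3 A hA
        have := h3 B hB
        omega
  obtain ⟨i, hi, h2⟩ := List.mem_iff_getElem.1 (List.mem_of_getLast? hπ.2)
  have h3 := h1 i hi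
  rw [h2, critical_empty e hg, card_image_compl hg] at h3
  omega

open Classical in
/-- The members of `S` which are not met by the matching and have at least `c ^ 2` free cells. -/
noncomputable def largeUnmet {ι : Type*} (M : ι → Finset (Fin (n + 1) × Fin n)) (S : Finset ι)
    (c : ℕ) (g : Fin n → Fin (n + 1)) (H : Finset (Fin n)) : Finset ι :=
  {C ∈ S | (∀ k ∈ H, (g k, k) ∉ M C) ∧ c ^ 2 ≤ (M C ∩ freeCells g H).card}

/-- A greedy matching meets most of the large sets of cells. -/
theorem exists_matching {ι : Type*} (M : ι → Finset (Fin (n + 1) × Fin n)) (S : Finset ι)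
    {c : ℕ} (hn : n + 1 = 6 * c) (t : ℕ) (ht : t ≤ n) :
    ∃ (g : Fin n → Fin (n + 1)) (H : Finset (Fin n)), g.Injective ∧ H.card = t ∧
      36 ^ t * (largeUnmet M S c g H).card ≤ 35 ^ t * S.card := by
  classical
  induction t with
  | zero =>
    refine ⟨Fin.castSucc, ∅, Fin.castSucc_injective n, rfl, ?_⟩
    rw [pow_zero, pow_zero, one_mul, one_mul]
    exact Finset.card_le_card (Finset.filter_subset _ _)
  | succ t ih =>
    obtain ⟨g, H, hg, hH, h1⟩ := ih (by omega)
    set T := largeUnmet M S c g H with hT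
    have hne : (freeCells g H).Nonempty := by
      obtain ⟨k, hk⟩ : ∃ k, k ∉ H := by
        by_contra! h
        have : H = Finset.univ := Finset.eq_univ_iff_forall.2 h
        rw [this, Finset.card_univ, Fintype.card_fin] at hH
        omega
      exact ⟨(g k, k), mem_freeCells.2 ⟨hk, fun k' hk' h => hk (hg h ▸ hk')⟩⟩
    -- Averaging: each member of `T` has at least `c ^ 2` of the at most `(6 * c) ^ 2` free cells,
    -- so some cell lies in a fraction `1 / 36` of them.
    obtain ⟨⟨i, k⟩, hik, h2⟩ : ∃ x ∈ freeCells g H,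
        T.card ≤ 36 * (T.filter fun C => x ∈ M C).card := by
      refine Finset.exists_le_of_sum_le hne ?_
      rw [Finset.sum_const, smul_eq_mul, ← Finset.mul_sum]
      have h3 : (freeCells g H).card ≤ 36 * c ^ 2 := by
        refine (Finset.card_le_univ _).trans ?_
        rw [Fintype.card_prod, Fintype.card_fin, Fintype.card_fin, hn]
        nlinarith
      have h4 : ∑ x ∈ freeCells g H, (T.filter fun C => x ∈ M C).card =
          ∑ C ∈ T, (M C ∩ freeCells g H).card := by
        simp only [Finset.card_filter]
        rw [Finset.sum_comm]
        refine Finset.sum_congr rfl fun C _ => ?_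
        rw [← Finset.card_filter, Finset.inter_comm, Finset.filter_mem_eq_inter]
      have h5 : T.card * c ^ 2 ≤ ∑ C ∈ T, (M C ∩ freeCells g H).card := by
        rw [← smul_eq_mul, ← Finset.sum_const]
        exact Finset.sum_le_sum fun C hC => (Finset.mem_filter.1 hC).2.2
      rw [h4]
      nlinarith
    obtain ⟨hk, hi⟩ := mem_freeCells.1 hik
    -- The swap matches `i` with `k`, keeps injectivity and does not affect `H`, as neither `g k`
    -- nor `i` is matched there.
    set g' : Fin n → Fin (n + 1) := Equiv.swap (g k) i ∘ g with hg'
    have h3 : ∀ k' ∈ H, g' k' = g k' := fun k' hk' =>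
      Equiv.swap_apply_of_ne_of_ne (fun h => hk (hg h ▸ hk')) (hi k' hk')
    have h4 : g' k = i := Equiv.swap_apply_left _ _
    refine ⟨g', insert k H, (Equiv.injective _).comp hg, by
      rw [Finset.card_insert_of_notMem hk, hH], ?_⟩
    have h5 : freeCells g' (insert k H) ⊆ freeCells g H := by
      rintro ⟨i', k'⟩ h
      obtain ⟨h6, h7⟩ := mem_freeCells.1 h
      exact mem_freeCells.2 ⟨fun h8 => h6 (Finset.mem_insert_of_mem h8),
        fun k'' h8 => h3 k'' h8 ▸ h7 k'' (Finset.mem_insert_of_mem h8)⟩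
    have h6 : largeUnmet M S c g' (insert k H) ⊆ T.filter fun C => ¬ (i, k) ∈ M C := by
      intro C hC
      obtain ⟨h7, h8, h9⟩ := Finset.mem_filter.1 hC
      refine Finset.mem_filter.2 ⟨Finset.mem_filter.2 ⟨h7, fun k' hk' => ?_, h9.trans
        (Finset.card_le_card (Finset.inter_subset_inter_left h5))⟩, ?_⟩
      · exact h3 k' hk' ▸ h8 k' (Finset.mem_insert_of_mem hk')
      · exact h4 ▸ h8 k (Finset.mem_insert_self _ _)
    have h7 := Finset.card_le_card h6
    have h8 := Finset.card_filter_add_card_filter_not (s := T) (fun C => (i, k) ∈ M C)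
    have h9 : 36 * (largeUnmet M S c g' (insert k H)).card ≤ 35 * T.card := by omega
    calc 36 ^ (t + 1) * (largeUnmet M S c g' (insert k H)).card
        = 36 ^ t * (36 * (largeUnmet M S c g' (insert k H)).card) := by ring
      _ ≤ 36 ^ t * (35 * T.card) := by gcongr
      _ = 35 * (36 ^ t * T.card) := by ring
      _ ≤ 35 * (35 ^ t * S.card) := by gcongr
      _ = 35 ^ (t + 1) * S.card := by ring

/-- The exponential lower bound for resolution refutations of the pigeonhole principle. -/
theorem resolution_lower_bound [DecidableEq σ] {e : Fin (n + 1) → Fin n → σ}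
    (he : ∀ i j k l, e i k = e j l → i = j ∧ k = l) {K : CNF σ}
    (hK : ∀ C ∈ K, ∃ i, ∀ f : Fin n → Fin (n + 1), f.Injective → Falsifies e f C →
      ∀ k, f k ≠ i) {π : List (Clause σ)} (hπ : IsResRefutation K π) {c : ℕ} (hc : 2 ≤ c)
    (hn : n + 1 = 6 * c) : 36 ^ (3 * c) ≤ 35 ^ (3 * c) * π.length := by
  obtain ⟨g, H, hg, hH, h1⟩ := exists_matching (cells e) π.toFinset hn (3 * c) (by omega)
  obtain ⟨C, hC, h2, h3⟩ := exists_intermediate_clause hg H hK hπ hc (by omega)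
  have h4 := card_critical_mul_le (e := e) hg H C
  have h5 : C ∈ largeUnmet (cells e) π.toFinset c g H := by
    refine Finset.mem_filter.2 ⟨by simpa using hC, fun k hk h => ?_, le_trans ?_ h4⟩
    · rw [critical_eq_empty he hk h, Finset.card_empty] at h2
      omega
    -- The number `a` of critical pigeons satisfies `c ≤ a ≤ 2 * c - 2`, and `3 * c` pigeons are
    -- unmatched, so both factors `a` and `3 * c - a` are at least `c`.
    · rw [sq]
      gcongr
      omega
  calc 36 ^ (3 * c) = 36 ^ (3 * c) * 1 := by ring
    _ ≤ 36 ^ (3 * c) * (largeUnmet (cells e) π.toFinset c g H).card := by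
      gcongr
      exact Finset.card_pos.2 ⟨C, h5⟩
    _ ≤ 35 ^ (3 * c) * π.toFinset.card := h1
    _ ≤ 35 ^ (3 * c) * π.length := by
      gcongr
      exact π.toFinset_card_le

end PigeonholeLower

end OrderedPC
namespace OrderedPC

open MvPolynomial

/-! ### Both parts of the theorem. -/

/-- The scalar in `hpigeon` covers both translations of a pigeon axiom: `c = 1` for `FPHP` and `c =
(-1) ^ n` for the clause polynomials. -/
theorem exists_refutation_of_fphp {F σ : Type*} [Field F] {Q : Set (MvPolynomial σ F)} {n : ℕ}
    (ord : LinearOrder σ) (t : Fin (n + 2) ↪ F) (x : Fin (n + 1) → Fin n → σ)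
    (hpigeon : ∀ i, ∃ c : F, c ≠ 0 ∧ C c * ∏ k, (1 - X (x i k)) ∈ Q)
    (hfun : ∀ i k l, k < l → X (x i k) * X (x i l) ∈ Q)
    (hhole : ∀ i j, i < j → ∀ k, X (x i k) * X (x j k) ∈ Q) :
    ∃ φs : List (NCFormula F σ), IsOFPCRefutation ord Q φs ∧ ofpcSize φs ≤ phpSize n := by
  refine exists_refutation_of_rows_cols ord t (List.ofFn fun i => List.ofFn (x i))
    (List.ofFn fun k => List.ofFn fun i => x i k) (by simp) (by simp) ?_ ?_ ?_ ?_ ?_ ?_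
  · simp [List.mem_ofFn]
  · simp [List.mem_ofFn]
  · intro a
    simp only [genProd, List.map_ofFn, List.prod_ofFn, Function.comp_def]
    exact Finset.prod_comm
  · simp only [List.mem_ofFn, forall_exists_index, forall_apply_eq_imp_iff, List.pairwise_ofFn]
    exact fun i k l h => hfun i k l h
  · simp only [List.mem_ofFn, forall_exists_index, forall_apply_eq_imp_iff, List.pairwise_ofFn]
    exact fun k i j h => hhole i j h k
  · simp only [List.mem_ofFn, forall_exists_index, forall_apply_eq_imp_iff]
    intro i
    obtain ⟨c, hc, h⟩ := hpigeon i
    refine ⟨c, hc, ?_⟩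
    convert h using 2
    simp [genProd, List.map_ofFn, List.prod_ofFn, Function.comp_def, sub_eq_add_neg]

theorem exists_fin_embedding {F : Type u} {n : ℕ}
    (h : ((n + 1 : ℕ) : Cardinal.{u}) < Cardinal.mk F) :
    Nonempty (Fin (n + 2) ↪ F) := by
  rcases finite_or_infinite F with hF | hF
  · have := Fintype.ofFinite F
    rw [Cardinal.mk_fintype, Nat.cast_lt] at h
    exact Function.Embedding.nonempty_of_card_le (by rw [Fintype.card_fin]; omega)
  · exact ⟨Fin.valEmbedding.trans (Infinite.natEmbedding F)⟩

/-- Only the first `n + 1` pigeons are used, hence the bound does not depend on `m`. -/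
theorem exists_fphp_refutation {F : Type u} [Field F] {n m : ℕ} (hnm : n < m)
    (hF : ((n + 1 : ℕ) : Cardinal.{u}) < Cardinal.mk F) (ord : LinearOrder (Fin m × Fin n)) :
    ∃ φs : List (NCFormula F (Fin m × Fin n)),
      IsOFPCRefutation ord (FPHP F m n) φs ∧ ofpcSize φs ≤ phpSize n := by
  obtain ⟨t⟩ := exists_fin_embedding hF
  refine exists_refutation_of_fphp ord t (fun i k => (Fin.castLE hnm i, k)) ?_ ?_ ?_
  · exact fun i => ⟨1, one_ne_zero, Or.inl ⟨_, by rw [C_1, one_mul]⟩⟩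
  · exact fun i k l h => Or.inr (Or.inl ⟨_, k, l, h, rfl⟩)
  · exact fun i j h k => Or.inr (Or.inr ⟨_, _, by simpa using h, k, rfl⟩)

/-- The variable which says that pigeon `i` sits in hole `k`. -/
def phpVar {n : ℕ} (i : Fin (n + 1)) (k : Fin n) : ℕ := Nat.pair i k

theorem phpVar_inj {n : ℕ} (i j : Fin (n + 1)) (k l : Fin n) (h : phpVar i k = phpVar j l) :
    i = j ∧ k = l := by
  simpa [phpVar, Nat.pair_eq_pair, Fin.ext_iff] using h

/-- The functional pigeonhole principle with `n + 1` pigeons and `n` holes as a CNF formula. -/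
def phpCNF (n : ℕ) : CNF ℕ :=
  (Finset.univ.image fun i : Fin (n + 1) => Finset.univ.image fun k => (phpVar i k, true)) ∪
  (({c : Fin (n + 1) × Fin n × Fin n | c.2.1 < c.2.2} : Finset _).image fun c =>
    {(phpVar c.1 c.2.1, false), (phpVar c.1 c.2.2, false)}) ∪
  (({c : Fin (n + 1) × Fin (n + 1) × Fin n | c.1 < c.2.1} : Finset _).image fun c =>
    {(phpVar c.1 c.2.2, false), (phpVar c.2.1 c.2.2, false)})

theorem mem_phpCNF {n : ℕ} {K : Clause ℕ} : K ∈ phpCNF n ↔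
    (∃ i : Fin (n + 1), K = Finset.univ.image fun k => (phpVar i k, true)) ∨
    (∃ (i : Fin (n + 1)) (k l : Fin n), k < l ∧ K = {(phpVar i k, false), (phpVar i l, false)}) ∨
    (∃ (i j : Fin (n + 1)) (k : Fin n), i < j ∧
      K = {(phpVar i k, false), (phpVar j k, false)}) := by
  simp [phpCNF, eq_comm]

theorem exists_phpCNF_refutation (F : Type*) [Field F] [Infinite F] (ord : LinearOrder ℕ)
    (n : ℕ) : ∃ φs : List (NCFormula F ℕ),
      IsOFPCRefutation ord (cnfPolys F (phpCNF n)) φs ∧ ofpcSize φs ≤ phpSize n := by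
  have hpair : ∀ v w : ℕ, v ≠ w →
      clausePoly F {(v, false), (w, false)} = X v * X w := by
    intro v w h
    rw [clausePoly, Finset.prod_pair (by simpa using h)]
    simp
  refine exists_refutation_of_fphp ord (Fin.valEmbedding.trans (Infinite.natEmbedding F)) phpVar
    ?_ ?_ ?_
  · intro i
    refine ⟨(-1) ^ n, by simp, _, mem_phpCNF.2 (Or.inl ⟨i, rfl⟩), ?_⟩
    rw [clausePoly, Finset.prod_image fun k _ l _ h => (phpVar_inj _ _ _ _ (Prod.mk.inj h).1).2]
    have : ((-1) ^ n : MvPolynomial ℕ F) = ∏ _k : Fin n, (-1) := by simp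
    rw [C_pow, C_neg, C_1, this, ← Finset.prod_mul_distrib]
    exact Finset.prod_congr rfl fun k _ => by simp
  · intro i k l h
    refine ⟨_, mem_phpCNF.2 (Or.inr (Or.inl ⟨i, k, l, h, rfl⟩)), ?_⟩
    rw [hpair _ _ fun h' => h.ne (phpVar_inj _ _ _ _ h').2]
  · intro i j h k
    refine ⟨_, mem_phpCNF.2 (Or.inr (Or.inr ⟨i, j, k, h, rfl⟩)), ?_⟩
    rw [hpair _ _ fun h' => h.ne (phpVar_inj _ _ _ _ h').1]

/-- A false pigeon clause leaves out its pigeon. The other clauses are never false under an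
injective assignment, so the witness `0` is arbitrary for them. -/
theorem exists_pigeon_of_mem_phpCNF {n : ℕ} {K : Clause ℕ} (hK : K ∈ phpCNF n) :
    ∃ i, ∀ f : Fin n → Fin (n + 1), f.Injective → Falsifies phpVar f K → ∀ k, f k ≠ i := by
  have hval : ∀ (f : Fin n → Fin (n + 1)) (i : Fin (n + 1)) (k : Fin n),
      Falsifies phpVar f K → (phpVar i k, false) ∈ K → f k = i := by
    intro f i k h hm
    have := h _ hm
    simp only [Bool.false_eq_true, iff_false, not_not] at this
    obtain ⟨k', hk'⟩ := this
    obtain ⟨h1, rfl⟩ := phpVar_inj _ _ _ _ hk'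
    exact h1
  rcases mem_phpCNF.1 hK with ⟨i, rfl⟩ | ⟨i, k, l, hkl, rfl⟩ | ⟨i, j, k, hij, rfl⟩
  · refine ⟨i, fun f _ h k hk => ?_⟩
    exact h (phpVar i k, true) (by simp) (by simpa using ⟨k, by rw [hk]⟩)
  · refine ⟨0, fun f hf h => absurd (hf ?_) hkl.ne⟩
    rw [hval f i k h (by simp), hval f i l h (by simp)]
  · refine ⟨0, fun f hf h => absurd ?_ hij.ne⟩
    rw [← hval f i k h (by simp), ← hval f j k h (by simp)]

theorem exists_eval_mul_pow_lt (q : Polynomial ℕ) :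
    ∃ c, 1 ≤ c ∧ q.eval c * 35 ^ (3 * (c + 1)) < 36 ^ (3 * (c + 1)) := by
  set r : ℝ := (35 / 36) ^ 3 with hr
  have hr0 : 0 < r := by positivity
  have hr1 : r < 1 := by norm_num [hr]
  have h1 : Filter.Tendsto (fun c : ℕ => ((q.eval c : ℕ) : ℝ) * r ^ c) Filter.atTop (nhds 0) := by
    have h2 : ∀ c : ℕ, ((q.eval c : ℕ) : ℝ) * r ^ c =
        ∑ i ∈ Finset.range (q.natDegree + 1), (q.coeff i : ℝ) * ((c : ℝ) ^ i * r ^ c) := by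
      intro c
      rw [Polynomial.eval_eq_sum_range, Nat.cast_sum, Finset.sum_mul]
      exact Finset.sum_congr rfl fun i _ => by push_cast; ring
    simp only [h2]
    rw [← Finset.sum_const_zero (s := Finset.range (q.natDegree + 1))]
    refine tendsto_finsetSum _ fun i _ => ?_
    simpa using (tendsto_pow_const_mul_const_pow_of_abs_lt_one i
      (by rwa [abs_of_pos hr0])).const_mul (q.coeff i : ℝ)
  obtain ⟨c, hc, h2⟩ := ((h1.eventually (gt_mem_nhds one_pos)).and
    (Filter.eventually_ge_atTop 1)).exists
  refine ⟨c, h2, ?_⟩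
  have h3 : ((q.eval c : ℕ) : ℝ) * r ^ (c + 1) < 1 := by
    refine lt_of_le_of_lt ?_ hc
    gcongr _ * ?_
    exact pow_le_pow_of_le_one hr0.le hr1.le (by omega)
  rw [hr, ← pow_mul, div_pow, ← mul_div_assoc, div_lt_one (by positivity)] at h3
  exact_mod_cast h3

theorem not_polySimulates_resolution_ofpc (F : Type*) [Field F] [Infinite F]
    (ord : LinearOrder ℕ) : ¬ PolySimulates resolution (ofpc F ord) := by
  rintro ⟨p, hp⟩
  -- The number of holes is `n = 6 * c + 5`, so that `n + 1 = 6 * (c + 1)`; the lower bound is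
  -- applied with `c + 1 ≥ 2`.
  obtain ⟨c, hc, hlt⟩ := exists_eval_mul_pow_lt
    (p.comp ((phpSize Polynomial.X).comp (6 * Polynomial.X + 5)))
  obtain ⟨φs, h1, h2⟩ := exists_phpCNF_refutation F ord (6 * c + 5)
  obtain ⟨t, ht, π, hπ, rfl⟩ := hp _ _ ⟨φs, h1, rfl⟩
  have h3 := resolution_lower_bound (phpVar_inj (n := 6 * c + 5))
    (fun K hK => exists_pigeon_of_mem_phpCNF hK) hπ (c := c + 1) (by omega) (by omega)
  have hmono : Monotone fun s : ℕ => p.eval s := by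
    intro a b hab
    simp only [Polynomial.eval_eq_sum_range]
    gcongr
  have h4 : π.length ≤ p.eval (phpSize (6 * c + 5)) := ht.trans (hmono h2)
  have h5 : (p.comp ((phpSize Polynomial.X).comp (6 * Polynomial.X + 5))).eval c =
      p.eval (phpSize (6 * c + 5)) := by
    simp [Polynomial.eval_comp, eval_phpSize]
  rw [h5] at hlt
  have h6 : 35 ^ (3 * (c + 1)) * π.length ≤ p.eval (phpSize (6 * c + 5)) * 35 ^ (3 * (c + 1)) := by
    rw [mul_comm]
    gcongr
  omega

end OrderedPC

theorem corollary5p7 :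
    (∃ sizeBound fieldBound : Polynomial ℕ,
      ∀ (n m : ℕ), n < m →
      ∀ (F : Type u) [Field F], ((fieldBound.eval n : ℕ) : Cardinal.{u}) < Cardinal.mk F →
      ∀ ord : LinearOrder (Fin m × Fin n),
        ∃ φs : List (OrderedPC.NCFormula F (Fin m × Fin n)),
          OrderedPC.IsOFPCRefutation ord (OrderedPC.FPHP F m n) φs ∧
          OrderedPC.ofpcSize φs ≤ sizeBound.eval n) ∧
    (∀ (F : Type u) [Field F] [Infinite F] (ord : LinearOrder ℕ),
      OrderedPC.StrictlyStronger (OrderedPC.ofpc F ord) OrderedPC.resolution) := by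
  refine ⟨⟨OrderedPC.phpSize Polynomial.X, Polynomial.X + 1, fun n m hnm F _ hF ord => ?_⟩,
    fun F _ _ ord => ⟨OrderedPC.polySimulates_ofpc_resolution F ord,
      OrderedPC.not_polySimulates_resolution_ofpc F ord⟩⟩
  rw [OrderedPC.eval_phpSize]
  exact OrderedPC.exists_fphp_refutation hnm (by simpa using hF) ord
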